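/- Let $\alpha,\beta\in\mathbb R$. On the manifold $M=\{(t,\rho,\varphi,\tilde z):\rho>0,\ \varphi\in\mathbb R/2\pi\mathbb Z\}$ put, for $\lambda>0$, $$F_\lambda=J_0(\rho/\lambda)\sin(t/\lambda),\quad \phi_\lambda=\alpha\sqrt\lambda\,F_\lambda,\quad \psi_\lambda=\beta\sqrt\lambda\,F_\lambda,$$ $$\gamma_\lambda=\frac{\alpha^2+\beta^2}{2\lambda}\rho^2\Big[J_0^2(\tfrac\rho\lambda)+J_1^2(\tfrac\rho\lambda)-2\tfrac\lambda\rho J_0(\tfrac\rho\lambda)J_1(\tfrac\rho\lambda)\sin^2(\tfrac t\lambda)\Big],$$ where $J_n$ are the Bessel functions of the first kind, and let $$g(\lambda)=e^{2(\gamma_\lambda-\psi_\lambda)}(-dt^2+d\rho^2)+\rho^2e^{-2\psi_\lambda}d\varphi^2+e^{2\psi_\lambda}d\tilde z^2 .$$ Let $T_{ab}(\lambda)=\partial_a\tilde\phi\,\partial_b\tilde\phi-\frac12 g_{ab}(\lambda)\,g^{cd}(\lambda)\,\partial_c\tilde\phi\,\partial_d\tilde\phi$ with $\tilde\phi=\phi_\lambda/(2\sqrt\pi)$.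 Put $$g^{(0)}=e^{2(\alpha^2+\beta^2)\rho/\pi}(-dt^2+d\rho^2)+\rho^2d\varphi^2+d\tilde z^2,\qquad h(\lambda)=g(\lambda)-g^{(0)},$$ and let $\nabla$ be the Levi-Civita connection of $g^{(0)}$, with which indices are also raised. A family $A(\lambda)$ of tensor fields on $M$ has weak limit $B$, written $B=\mathrm{w\text{-}lim}_{\lambda\to0}A(\lambda)$, if $\int_M f\cdot A(\lambda)\to\int_M f\cdot B$ as $\lambda\to0^+$ for every smooth compactly supported tensor field $f$ of dual type (integrals with respect to the volume element of $g^{(0)}$). Then: 1. The components of $g(\lambda)$ converge to those of $g^{(0)}$ as $\lambda\to0^+$, locally uniformly on $M$. 2. $T^{(0)}_{ab}:=\mathrm{w\text{-}lim}_{\lambda\to0}T_{ab}(\lambda)$ exists; its only nonzero components are $T^{(0)}_{tt}=T^{(0)}_{\rho\rho}=\dfrac{\alpha^2}{8\pi^2\rho}$. 3. The only nonzero components of the Einstein tensor of $g^{(0)}$ are $G_{tt}(g^{(0)})=G_{\rho\rho}(g^{(0)})=\dfrac{\alpha^2+\beta^2}{\pi\rho}$. 4. Consequently the effective energy-momentum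 tensor $t^{(0)}_{ab}:=\frac1{8\pi}G_{ab}(g^{(0)})-T^{(0)}_{ab}$ has only the nonzero components $t^{(0)}_{tt}=t^{(0)}_{\rho\rho}=\dfrac{\beta^2}{8\pi^2\rho}$. It is traceless with respect to $g^{(0)}$, satisfies the weak energy condition ($t^{(0)}_{ab}v^av^b\ge0$ for every $g^{(0)}$-timelike $v$), and does not depend on $\alpha$. 5. The weak limit $\mu_{abcdef}:=\mathrm{w\text{-}lim}_{\lambda\to0}\big[\nabla_ah_{cd}(\lambda)\nabla_bh_{ef}(\lambda)\big]$ exists and is a smooth tensor field on $M$. It satisfies $\mu_{abcdef}=\mu_{(ab)(cd)(ef)}=\mu_{abefcd}$, and, up to these symmetries, its only nonzero components are $$\mu_{tttttt}=\mu_{tt\rho\rho\rho\rho}=-\mu_{tttt\rho\rho}=\mu_{\rho\rho tttt}=\mu_{\rho\rho\rho\rho\rho\rho}=-\mu_{\rho\rho tt\rho\rho}=\Big[\tfrac2\pi\beta^2\rho^{-1}+\tfrac1{\pi^2}(\alpha^2+\beta^2)^2\Big]e^{4(\alpha^2+\beta^2)\rho/\pi},$$ $$\mu_{tt\varphi\varphi\varphi\varphi}=\mu_{\rho\rho\varphi\varphi\varphi\varphi}=\tfrac2\pi\beta^2\rho^3,\qquad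 \mu_{tt\tilde z\tilde z\tilde z\tilde z}=\mu_{\rho\rho\tilde z\tilde z\tilde z\tilde z}=\tfrac2\pi\beta^2\rho^{-1},$$ $$\mu_{tt\rho\rho\varphi\varphi}=-\mu_{tttt\varphi\varphi}=\mu_{\rho\rho\rho\rho\varphi\varphi}=-\mu_{\rho\rho tt\varphi\varphi}=\tfrac2\pi\beta^2\rho\,e^{2(\alpha^2+\beta^2)\rho/\pi},$$ $$\mu_{tt\rho\rho\tilde z\tilde z}=-\mu_{tttt\tilde z\tilde z}=\mu_{\rho\rho\rho\rho\tilde z\tilde z}=-\mu_{\rho\rho tt\tilde z\tilde z}=-\tfrac2\pi\beta^2\rho^{-1}e^{2(\alpha^2+\beta^2)\rho/\pi},$$ $$\mu_{tt\varphi\varphi\tilde z\tilde z}=\mu_{\rho\rho\varphi\varphi\tilde z\tilde z}=-\tfrac2\pi\beta^2\rho .$$ 6. The tensor $\mu$ reproduces the same $t^{(0)}$ through the Green–Wald formula: $$8\pi t^{(0)}_{ab}=\tfrac18\big(-\mu^c{}_c{}^{de}{}_{de}-\mu^c{}_c{}^d{}_d{}^e{}_e+2\mu^{cd}{}_c{}^e{}_{de}\big)g^{(0)}_{ab}+\tfrac12\mu^{cd}{}_{acbd}-\tfrac12\mu^c{}_{ca}{}^d{}_{bd}+\tfrac14\mu_{ab}{}^{cd}{}_{cd}-\tfrac12\mu^c{}_{(ab)c}{}^d{}_d+\tfrac34\mu^c{}_{cab}{}^d{}_d-\tfrac12\mu^{cd}{}_{abcd}.$$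 -/

import Mathlib

open Filter Topology MeasureTheory
open scoped ContDiff

noncomputable section

namespace EinsteinRosen

/-! ### Tensor calculus in a coordinate chart of a four-dimensional spacetime -/

/-- Coordinates of an event, in the order `0 = t`, `1 = ρ`, `2 = φ`, `3 = z`. -/
abbrev Pt : Type := Fin 4 → ℝ

/-- Components of a symmetric (or general) covariant tensor field of rank two. -/
abbrev Field2 : Type := Pt → Matrix (Fin 4) (Fin 4) ℝ

/-- Components of a tensor field of rank `n`. -/
abbrev TensorField (n : ℕ) : Type := Pt → (Fin n → Fin 4) → ℝ

/-- The partial derivative `∂ᵢ f` at `p`. -/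
def pd (i : Fin 4) (f : Pt → ℝ) (p : Pt) : ℝ :=
  deriv (fun s : ℝ => f (Function.update p i s)) (p i)

/-- Christoffel symbols `Γ^c_{ab}` of the metric `g`. -/
def christoffel (g : Field2) (c a b : Fin 4) (p : Pt) : ℝ :=
  (1 / 2) * ∑ d, (g p)⁻¹ c d *
    (pd a (fun q => g q b d) p + pd b (fun q => g q a d) p - pd d (fun q => g q a b) p)

/-- Ricci tensor
`R_{ab} = ∂_c Γ^c_{ab} - ∂_b Γ^c_{ac} + Γ^c_{cd} Γ^d_{ab} - Γ^c_{bd} Γ^d_{ac}`. -/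
def ricci (g : Field2) (p : Pt) (a b : Fin 4) : ℝ :=
  (∑ c, (pd c (christoffel g c a b) p - pd b (christoffel g c a c) p)) +
    ∑ c, ∑ d, (christoffel g c c d p * christoffel g d a b p -
      christoffel g c b d p * christoffel g d a c p)

/-- Scalar curvature `g^{ab} R_{ab}`. -/
def scalarCurvature (g : Field2) (p : Pt) : ℝ :=
  ∑ a, ∑ b, (g p)⁻¹ a b * ricci g p a b

/-- Einstein tensor `G_{ab} = R_{ab} - (1/2) R g_{ab}`. -/
def einstein (g : Field2) (p : Pt) (a b : Fin 4) : ℝ :=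
  ricci g p a b - (1 / 2) * scalarCurvature g p * g p a b

/-- Covariant derivative `∇_a h_{cd}` with respect to the Levi-Civita connection of `g`. -/
def covDeriv (g h : Field2) (p : Pt) (a c d : Fin 4) : ℝ :=
  pd a (fun q => h q c d) p
    - (∑ e, christoffel g e a c p * h p e d) - ∑ e, christoffel g e a d p * h p c e

/-- Energy-momentum tensor `T_{ab} = ∂_a u ∂_b u - (1/2) g_{ab} g^{cd} ∂_c u ∂_d u` of a massless
scalar field `u` minimally coupled to `g`. -/
def scalarStress (g : Field2) (u : Pt → ℝ) (p : Pt) (a b : Fin 4) : ℝ :=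
  pd a u p * pd b u p
    - (1 / 2) * g p a b * ∑ c, ∑ d, (g p)⁻¹ c d * pd c u p * pd d u p

/-- Trace `g^{ab} S_{ab}`. -/
def trace (g : Field2) (S : Pt → Fin 4 → Fin 4 → ℝ) (p : Pt) : ℝ :=
  ∑ a, ∑ b, (g p)⁻¹ a b * S p a b

/-- Weak energy condition at `p`: `S_{ab} v^a v^b ≥ 0` for every timelike vector `v`
(signature `-+++`). -/
def WeakEnergyAt (g : Field2) (S : Pt → Fin 4 → Fin 4 → ℝ) (p : Pt) : Prop :=
  ∀ v : Fin 4 → ℝ, (∑ a, ∑ b, g p a b * v a * v b) < 0 → 0 ≤ ∑ a, ∑ b, S p a b * v a * v b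

/-! ### Weak limits on the spacetime manifold `ℝ × (0, ∞) × S¹ × ℝ` -/

/-- The coordinate domain `ρ > 0`. -/
def region : Set Pt := {p | 0 < p 1}

/-- One period `0 ≤ φ < 2π` of the angular coordinate, with `ρ > 0`. -/
def fundamentalDomain : Set Pt := {p | 0 < p 1 ∧ 0 ≤ p 2 ∧ p 2 < 2 * Real.pi}

/-- Components of a smooth compactly supported test tensor field on `ℝ × (0, ∞) × S¹ × ℝ`:
smooth functions of the coordinates, `2π`-periodic in `φ`, whose support is bounded in `t`, `ρ`, `z`
and bounded away from the axis. -/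
structure IsTestField {n : ℕ} (f : TensorField n) : Prop where
  smooth : ∀ i, ContDiff ℝ ∞ (fun p => f p i)
  periodic : ∀ p, f (Function.update p 2 (p 2 + 2 * Real.pi)) = f p
  support : ∃ r R : ℝ, 0 < r ∧ ∀ p i, f p i ≠ 0 →
    r ≤ p 1 ∧ p 1 ≤ R ∧ |p 0| ≤ R ∧ |p 3| ≤ R

/-- The integrand `f^{a₁…aₙ} A_{a₁…aₙ} √|det g|`. -/
def pairing (g : Field2) {n : ℕ} (f A : TensorField n) (p : Pt) : ℝ :=
  (∑ i, f p i * A p i) * Real.sqrt |(g p).det|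

/-- `B` is the weak limit of `A lam` as `lam → 0⁺`: for every smooth compactly supported test tensor
field `f`, the integral of `f · A lam` tends to the integral of `f · B`. Integrals are taken with
respect to the volume element of the background metric `g`, and are required to exist. -/
def IsWeakLimit (g : Field2) {n : ℕ} (A : ℝ → TensorField n) (B : TensorField n) : Prop :=
  ∀ f : TensorField n, IsTestField f →
    (∀ lam > 0, IntegrableOn (pairing g f (A lam)) fundamentalDomain) ∧
    IntegrableOn (pairing g f B) fundamentalDomain ∧
    Tendsto (fun lam => ∫ p in fundamentalDomain, pairing g f (A lam) p) (𝓝[>] 0)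
      (𝓝 (∫ p in fundamentalDomain, pairing g f B p))

/-! ### The Green-Wald formula -/

/-- The right-hand side of the Green-Wald formula: the expression
`(1/8)(-μ^c_c^{de}_{de} - μ^c_c^d_d^e_e + 2 μ^{cd}_c^e_{de}) g_{ab} + (1/2) μ^{cd}_{acbd}
 - (1/2) μ^c_{ca}^d_{bd} + (1/4) μ_{ab}^{cd}_{cd} - (1/2) μ^c_{(ab)c}^d_d + (3/4) μ^c_{cab}^d_d
 - (1/2) μ^{cd}_{abcd}`,
with indices raised by `g`. A primed index is contracted with the corresponding unprimed one. -/
def greenWald (g : Field2) (μ : TensorField 6) (p : Pt) (a b : Fin 4) : ℝ :=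
  (1 / 8) * (∑ c, ∑ c', ∑ d, ∑ d', ∑ e, ∑ e',
      (g p)⁻¹ c c' * (g p)⁻¹ d d' * (g p)⁻¹ e e' *
        (- μ p ![c, c', d, e, d', e'] - μ p ![c, c', d, d', e, e']
          + 2 * μ p ![c, d, c', e, d', e'])) * g p a b
  + ∑ c, ∑ c', ∑ d, ∑ d', (g p)⁻¹ c c' * (g p)⁻¹ d d' *
      ((1 / 2) * μ p ![c, d, a, c', b, d']
        - (1 / 2) * μ p ![c, c', a, d, b, d']
        + (1 / 4) * μ p ![a, b, c, d, c', d']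
        - (1 / 2) * ((μ p ![c, a, b, c', d, d'] + μ p ![c, b, a, c', d, d']) / 2)
        + (3 / 4) * μ p ![c, c', a, b, d, d']
        - (1 / 2) * μ p ![c, d, a, b, c', d'])

/-! ### The family of Einstein-Rosen waves coupled to a scalar field -/

/-- Bessel function of the first kind of integer order `n`, through Bessel's integral
`J_n(x) = (1/π) ∫_0^π cos(nθ - x sin θ) dθ`. -/
def besselJ (n : ℕ) (x : ℝ) : ℝ :=
  (1 / Real.pi) * ∫ θ in (0 : ℝ)..Real.pi, Real.cos (n * θ - x * Real.sin θ)

/-- `F(t, ρ) = J₀(ρ/lam) sin(t/lam)`. -/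
def waveF (lam : ℝ) (p : Pt) : ℝ := besselJ 0 (p 1 / lam) * Real.sin (p 0 / lam)

/-- The rescaled scalar field `φ = α √lam F`. -/
def phi (α lam : ℝ) (p : Pt) : ℝ := α * Real.sqrt lam * waveF lam p

/-- The scalar field `φ / (2 √π)` that enters the energy-momentum tensor. -/
def scalarField (α lam : ℝ) (p : Pt) : ℝ := 1 / (2 * Real.sqrt Real.pi) * phi α lam p

/-- The metric function `ψ = β √lam F`. -/
def psi (β lam : ℝ) (p : Pt) : ℝ := β * Real.sqrt lam * waveF lam p

/-- The metric function `γ`. -/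
def gam (α β lam : ℝ) (p : Pt) : ℝ :=
  (α ^ 2 + β ^ 2) / (2 * lam) * p 1 ^ 2 *
    (besselJ 0 (p 1 / lam) ^ 2 + besselJ 1 (p 1 / lam) ^ 2
      - 2 * (lam / p 1) * besselJ 0 (p 1 / lam) * besselJ 1 (p 1 / lam)
        * Real.sin (p 0 / lam) ^ 2)

/-- The metric `e^{2(γ-ψ)}(-dt² + dρ²) + ρ² e^{-2ψ} dφ² + e^{2ψ} dz²`. -/
def metric (α β lam : ℝ) : Field2 := fun p =>
  Matrix.diagonal ![
    -Real.exp (2 * (gam α β lam p - psi β lam p)),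
    Real.exp (2 * (gam α β lam p - psi β lam p)),
    p 1 ^ 2 * Real.exp (-2 * psi β lam p),
    Real.exp (2 * psi β lam p)]

/-- The background metric `e^{2(α²+β²)ρ/π}(-dt² + dρ²) + ρ² dφ² + dz²`. -/
def background (α β : ℝ) : Field2 := fun p =>
  Matrix.diagonal ![
    -Real.exp (2 * (α ^ 2 + β ^ 2) * p 1 / Real.pi),
    Real.exp (2 * (α ^ 2 + β ^ 2) * p 1 / Real.pi),
    p 1 ^ 2,
    1]

/-- `h = g(lam) - g⁽⁰⁾`. -/
def perturbation (α β lam : ℝ) : Field2 := fun p => metric α β lam p - background α β p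

/-- The energy-momentum tensor `T_{ab}(lam)` of the scalar field. -/
def stress (α β lam : ℝ) (p : Pt) (a b : Fin 4) : ℝ :=
  scalarStress (metric α β lam) (scalarField α lam) p a b

/-- `∇_a h_{cd} ∇_b h_{ef}`, with the indices in the order `a b c d e f` and `∇` the derivative
operator of the background metric. -/
def gradProduct (α β lam : ℝ) : TensorField 6 := fun p i =>
  covDeriv (background α β) (perturbation α β lam) p (i 0) (i 2) (i 3) *
    covDeriv (background α β) (perturbation α β lam) p (i 1) (i 4) (i 5)

/-- `T⁽⁰⁾`, with `T⁽⁰⁾_tt = T⁽⁰⁾_ρρ = α²/(8π²ρ)` and no other nonzero components. -/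
def weakStress (α : ℝ) (p : Pt) (a b : Fin 4) : ℝ :=
  if a = b ∧ (a = 0 ∨ a = 1) then α ^ 2 / (8 * Real.pi ^ 2 * p 1) else 0

/-- The effective energy-momentum tensor `t⁽⁰⁾ = G(g⁽⁰⁾)/(8π) - T⁽⁰⁾`. -/
def effectiveStress (α β : ℝ) (p : Pt) (a b : Fin 4) : ℝ :=
  einstein (background α β) p a b / (8 * Real.pi) - weakStress α p a b

/-- The array of components `μ_{tt cc ee} = μ_{ρρ cc ee}` (row `c`, column `e`). -/
def muTable (α β : ℝ) (p : Pt) : Matrix (Fin 4) (Fin 4) ℝ :=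
  let ρ := p 1
  let E := Real.exp (2 * (α ^ 2 + β ^ 2) * ρ / Real.pi)
  let s := 2 / Real.pi * β ^ 2
  let K := (s * ρ⁻¹ + 1 / Real.pi ^ 2 * (α ^ 2 + β ^ 2) ^ 2)
    * Real.exp (4 * (α ^ 2 + β ^ 2) * ρ / Real.pi)
  !![K, -K, -(s * ρ * E), s * ρ⁻¹ * E;
     -K, K, s * ρ * E, -(s * ρ⁻¹ * E);
     -(s * ρ * E), s * ρ * E, s * ρ ^ 3, -(s * ρ);
     s * ρ⁻¹ * E, -(s * ρ⁻¹ * E), -(s * ρ), s * ρ⁻¹]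

/-- The tensor `μ_{abcdef}`: nonzero components require `a = b ∈ {t, ρ}`, `c = d`, `e = f`. -/
def mu (α β : ℝ) : TensorField 6 := fun p i =>
  if i 0 = i 1 ∧ (i 0 = 0 ∨ i 0 = 1) ∧ i 2 = i 3 ∧ i 4 = i 5 then
    muTable α β p (i 2) (i 4) else 0

end EinsteinRosen

end

open EinsteinRosen

namespace EinsteinRosen

/-! ### Bessel functions -/

/-! Put `X = ρ/lam - δ` and `s = t/lam`. For large `x`, `√x J₀(x)` and `√x J₁(x)` approach `√(2/π)
cos (x - δ)` and `√(2/π) sin (x - δ)` (`exists_phase_besselJ`). Since `ψ = O(√lam)` and `x (J₀² +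
J₁²) → 2/π`, the metric functions converge, `ψ → 0` and `γ → (α² + β²)ρ/π`, and with them the
metric. Their first derivatives do not: up to a locally uniformly small error, `∂φ` and `∂ψ` are
combinations of `cos (X ± s)`, and `∂γ` minus its mean is a combination of `cos (2X ± 2s)`, with
amplitudes continuous in `ρ`.

By Riemann–Lebesgue, the product of two of these four waves has weak limit `1/2` if they coincide
and `0` otherwise (`weakConv_wave_mul_wave`). A product of two wave forms therefore converges weakly
to half the inner product of their amplitude vectors (`HasWaveForm.weakConv_mul`). Both `T` and `∇h
∇h` are built from such products with convergent coefficients, so their limits reduce to finite sums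
(`weakConv_stress`, `weakConv_gradProduct`). Cross terms between `∂γ` and `∂ψ` vanish because the
frequencies differ, and mixed `tρ` terms vanish because the waves `X + s` and `X - s` contribute
with opposite signs.

The shape of the Bessel asymptotics comes from an energy estimate and variation of constants for the
equation of `√x J₀`. The amplitude `2/π` comes from the singularity of the Laplace transform of `J₀`
at the resonance `i`. The exact phase `δ` is never needed, since the averages do not see it. The
curvature of the background and the Green–Wald identity are finite computations with diagonal
metrics. -/

lemma hasDerivAt_besselJ (n : ℕ) (x : ℝ) :
    HasDerivAt (besselJ n)
      ((1 / Real.pi) * ∫ θ in (0 : ℝ)..Real.pi, Real.sin (n * θ - x * Real.sin θ) * Real.sin θ) x := by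
  have h := intervalIntegral.hasDerivAt_integral_of_dominated_loc_of_deriv_le (μ := volume)
    (a := 0) (b := Real.pi) (s := Set.univ) (x₀ := x) (bound := fun _ => 1)
    (F := fun x θ => Real.cos (n * θ - x * Real.sin θ))
    (F' := fun x θ => Real.sin (n * θ - x * Real.sin θ) * Real.sin θ)
    Filter.univ_mem (Eventually.of_forall fun y => by
      apply Continuous.aestronglyMeasurable; fun_prop)
    (by apply Continuous.intervalIntegrable; fun_prop)
    (by apply Continuous.aestronglyMeasurable; fun_prop)
    (Eventually.of_forall fun θ _ y _ => by
      rw [Real.norm_eq_abs, abs_mul]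
      exact mul_le_one₀ (Real.abs_sin_le_one _) (abs_nonneg _) (Real.abs_sin_le_one _))
    (by simp)
    (Eventually.of_forall fun θ _ y _ => by
      have h1 : HasDerivAt (fun y : ℝ => (n : ℝ) * θ - y * Real.sin θ) (-Real.sin θ) y := by
        simpa using ((hasDerivAt_id y).mul_const (Real.sin θ)).const_sub ((n : ℝ) * θ)
      convert! h1.cos using 1
      ring)
  exact h.2.const_mul _

lemma besselJ_zero_eq (x : ℝ) :
    besselJ 0 x = (1 / Real.pi) * ∫ θ in (0 : ℝ)..Real.pi, Real.cos (x * Real.sin θ) := by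
  simp [besselJ]

/-- The reflection `θ ↦ π - θ` preserves `sin θ` and flips `cos θ`, so the integrand is odd about
`π/2`. -/
lemma integral_cos_mul_cos_mul_sin (x : ℝ) :
    ∫ θ in (0 : ℝ)..Real.pi, Real.cos θ * Real.cos (x * Real.sin θ) = 0 := by
  have h := intervalIntegral.integral_comp_sub_left
    (a := 0) (b := Real.pi) (fun θ => Real.cos θ * Real.cos (x * Real.sin θ)) Real.pi
  simp only [Real.cos_pi_sub, Real.sin_pi_sub, neg_mul, intervalIntegral.integral_neg, sub_self,
    sub_zero] at h
  linarith

lemma besselJ_one_eq (x : ℝ) : besselJ 1 x =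
    (1 / Real.pi) * ∫ θ in (0 : ℝ)..Real.pi, Real.sin θ * Real.sin (x * Real.sin θ) := by
  have h : ∀ θ, Real.cos ((1 : ℕ) * θ - x * Real.sin θ) =
      Real.cos θ * Real.cos (x * Real.sin θ) + Real.sin θ * Real.sin (x * Real.sin θ) := by
    intro θ; rw [Nat.cast_one, one_mul, Real.cos_sub]
  simp only [besselJ, h]
  rw [intervalIntegral.integral_add (by apply Continuous.intervalIntegrable; fun_prop)
    (by apply Continuous.intervalIntegrable; fun_prop), integral_cos_mul_cos_mul_sin, zero_add]

lemma hasDerivAt_besselJ_zero (x : ℝ) : HasDerivAt (besselJ 0) (-besselJ 1 x) x := by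
  convert hasDerivAt_besselJ 0 x using 1
  rw [besselJ_one_eq, ← mul_neg, ← intervalIntegral.integral_neg]
  congr 1
  refine intervalIntegral.integral_congr fun θ _ => ?_
  simp only [Nat.cast_zero, zero_mul, zero_sub, Real.sin_neg]
  ring

/-- Multiplying by `x` avoids the singular term `J₁/x`, so the identity also holds at `0`. -/
lemma hasDerivAt_mul_besselJ_one (x : ℝ) :
    HasDerivAt (fun x => x * besselJ 1 x) (x * besselJ 0 x) x := by
  convert! (hasDerivAt_id x).mul (hasDerivAt_besselJ 1 x) using 1
  have e1 : ∫ θ in (0 : ℝ)..Real.pi, Real.sin ((1 : ℕ) * θ - x * Real.sin θ) * Real.sin θ =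
      (∫ θ in (0 : ℝ)..Real.pi, Real.sin θ ^ 2 * Real.cos (x * Real.sin θ)) -
      ∫ θ in (0 : ℝ)..Real.pi, Real.cos θ * Real.sin θ * Real.sin (x * Real.sin θ) := by
    rw [← intervalIntegral.integral_sub (by apply Continuous.intervalIntegrable; fun_prop)
      (by apply Continuous.intervalIntegrable; fun_prop)]
    refine intervalIntegral.integral_congr fun θ _ => ?_
    simp only [Nat.cast_one, one_mul, Real.sin_sub]
    ring
  have e2 : ∫ θ in (0 : ℝ)..Real.pi, Real.cos θ * Real.sin θ * Real.sin (x * Real.sin θ) = 0 := by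
    have h := intervalIntegral.integral_comp_sub_left (a := 0) (b := Real.pi)
      (fun θ => Real.cos θ * Real.sin θ * Real.sin (x * Real.sin θ)) Real.pi
    simp only [Real.cos_pi_sub, Real.sin_pi_sub, neg_mul, intervalIntegral.integral_neg, sub_self,
      sub_zero] at h
    linarith
  -- The integrand is the `θ`-derivative of `cos θ sin (x sin θ)`, which vanishes at `0` and at `π`.
  have e3 : (∫ θ in (0 : ℝ)..Real.pi, (x * Real.cos (x * Real.sin θ) -
      (Real.sin θ * Real.sin (x * Real.sin θ) + x * (Real.sin θ ^ 2 * Real.cos (x * Real.sin θ)))))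
      = 0 := by
    have h := intervalIntegral.integral_eq_sub_of_hasDerivAt (a := 0) (b := Real.pi)
      (f := fun θ => Real.cos θ * Real.sin (x * Real.sin θ))
      (f' := fun θ => x * Real.cos (x * Real.sin θ) - (Real.sin θ * Real.sin (x * Real.sin θ) +
        x * (Real.sin θ ^ 2 * Real.cos (x * Real.sin θ)))) (fun θ _ => by
        convert! (Real.hasDerivAt_cos θ).mul ((Real.hasDerivAt_sin θ).const_mul x).sin using 1
        have := Real.sin_sq_add_cos_sq θ
        linear_combination (-x * Real.cos (x * Real.sin θ)) * this)
      (by apply Continuous.intervalIntegrable; fun_prop)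
    simpa using h
  rw [intervalIntegral.integral_sub (by apply Continuous.intervalIntegrable; fun_prop)
      (by apply Continuous.intervalIntegrable; fun_prop),
      intervalIntegral.integral_add (by apply Continuous.intervalIntegrable; fun_prop)
      (by apply Continuous.intervalIntegrable; fun_prop),
      intervalIntegral.integral_const_mul, intervalIntegral.integral_const_mul] at e3
  rw [e1, e2, besselJ_zero_eq, besselJ_one_eq]
  simp only [id]
  linear_combination (1 / Real.pi) * e3

lemma hasDerivAt_besselJ_one {x : ℝ} (hx : x ≠ 0) :
    HasDerivAt (besselJ 1) (besselJ 0 x - besselJ 1 x / x) x := by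
  have h1 := hasDerivAt_besselJ 1 x
  have h2 := ((hasDerivAt_id x).mul h1).unique (hasDerivAt_mul_besselJ_one x)
  simp only [id] at h2
  convert h1 using 1
  field_simp
  field_simp at h2
  linarith

@[fun_prop]
lemma continuous_besselJ (n : ℕ) : Continuous (besselJ n) :=
  continuous_iff_continuousAt.2 fun x => (hasDerivAt_besselJ n x).continuousAt

lemma abs_besselJ_le_one (n : ℕ) (x : ℝ) : |besselJ n x| ≤ 1 := by
  have h := intervalIntegral.norm_integral_le_of_norm_le_const (a := 0) (b := Real.pi) (C := 1)
    (f := fun θ => Real.cos (n * θ - x * Real.sin θ)) (fun θ _ => Real.abs_cos_le_one _)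
  rw [sub_zero, abs_of_pos Real.pi_pos, one_mul, Real.norm_eq_abs] at h
  rw [besselJ, abs_mul, abs_of_pos (by positivity : 0 < 1 / Real.pi), one_div, inv_mul_le_iff₀
    Real.pi_pos, mul_one]
  exact h

lemma besselJ_zero_zero : besselJ 0 0 = 1 := by
  simp [besselJ, Real.pi_ne_zero]

/-! ### Large-argument asymptotics of `J₀` and `J₁`, up to two constants. -/

/-- The bound on `P'` makes `P - K/x` increasing and `P + K/x` decreasing. Every value of the first
lies below every value of the second, so the supremum of the first separates them and serves as the
limit. -/
lemma exists_abs_sub_le_div_of_deriv_le {P P' : ℝ → ℝ} {K : ℝ} (hK : 0 ≤ K)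
    (hP : ∀ x, 1 ≤ x → HasDerivAt P (P' x) x) (hb : ∀ x, 1 ≤ x → |P' x| ≤ K / x ^ 2) :
    ∃ p, ∀ x, 1 ≤ x → |P x - p| ≤ K / x := by
  have hK' : ∀ x : ℝ, 1 ≤ x → HasDerivAt (fun x => K / x) (-(K / x ^ 2)) x := fun x hx => by
    have := (hasDerivAt_inv (by positivity : x ≠ 0)).const_mul K
    convert! this using 1
    ring
  have h1 : MonotoneOn (fun x => P x - K / x) (Set.Ici 1) := by
    refine monotoneOn_of_deriv_nonneg (convex_Ici 1)
      (fun x hx => ((hP x hx).sub (hK' x hx)).continuousAt.continuousWithinAt)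
      (fun x hx => ?_) fun x hx => ?_ <;> rw [interior_Ici] at hx
    · exact ((hP x hx.le).sub (hK' x hx.le)).differentiableAt.differentiableWithinAt
    · rw [((hP x hx.le).fun_sub (hK' x hx.le)).deriv]
      linarith [(abs_le.1 (hb x hx.le)).1]
  have h2 : AntitoneOn (fun x => P x + K / x) (Set.Ici 1) := by
    refine antitoneOn_of_deriv_nonpos (convex_Ici 1)
      (fun x hx => ((hP x hx).add (hK' x hx)).continuousAt.continuousWithinAt)
      (fun x hx => ?_) fun x hx => ?_ <;> rw [interior_Ici] at hx
    · exact ((hP x hx.le).add (hK' x hx.le)).differentiableAt.differentiableWithinAt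
    · rw [((hP x hx.le).fun_add (hK' x hx.le)).deriv]
      linarith [(abs_le.1 (hb x hx.le)).2]
  have h3 : ∀ x y, 1 ≤ x → 1 ≤ y → P x - K / x ≤ P y + K / y := fun x y hx hy => by
    have hm : 1 ≤ max x y := hx.trans (le_max_left _ _)
    have e1 := h1 hx hm (le_max_left _ _)
    have e2 := h2 hy hm (le_max_right _ _)
    have : 0 ≤ K / max x y := by positivity
    simp only at e1 e2
    linarith
  refine ⟨sSup ((fun x => P x - K / x) '' Set.Ici 1), fun x hx => abs_le.2 ⟨?_, ?_⟩⟩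
  · have : sSup ((fun x => P x - K / x) '' Set.Ici 1) ≤ P x + K / x :=
      csSup_le (Set.nonempty_Ici.image _) (by rintro _ ⟨y, hy, rfl⟩; exact h3 y x hy hx)
    linarith
  · have : P x - K / x ≤ sSup ((fun x => P x - K / x) '' Set.Ici 1) :=
      le_csSup ⟨P 1 + K / 1, by rintro _ ⟨y, hy, rfl⟩; exact h3 y 1 hy le_rfl⟩ ⟨x, hx, rfl⟩
    linarith

lemma hasDerivAt_sqrt_mul_besselJ_zero {x : ℝ} (hx : 0 < x) :
    HasDerivAt (fun x => √x * besselJ 0 x) (besselJ 0 x / (2 * √x) - √x * besselJ 1 x) x := by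
  convert! (Real.hasDerivAt_sqrt hx.ne').mul (hasDerivAt_besselJ_zero x) using 1
  ring

/-- The factor `√x` removes the first-order term of Bessel's equation: `u = √x J₀` satisfies `u'' +
(1 + 1/(4x²)) u = 0`, a harmonic oscillator with a perturbation integrable at infinity. -/
lemma hasDerivAt_deriv_sqrt_mul_besselJ_zero {x : ℝ} (hx : 0 < x) :
    HasDerivAt (fun x => besselJ 0 x / (2 * √x) - √x * besselJ 1 x)
      (-(1 + 1 / (4 * x ^ 2)) * (√x * besselJ 0 x)) x := by
  have hs := Real.hasDerivAt_sqrt hx.ne'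
  have hs0 : √x ≠ 0 := (Real.sqrt_pos.2 hx).ne'
  convert! ((hasDerivAt_besselJ_zero x).div (hs.const_mul 2) (by positivity)).sub
    (hs.mul (hasDerivAt_besselJ_one hx.ne')) using 1
  obtain ⟨r, hr, rfl⟩ : ∃ r : ℝ, 0 < r ∧ x = r ^ 2 := ⟨√x, Real.sqrt_pos.2 hx, by
    rw [Real.sq_sqrt hx.le]⟩
  rw [Real.sqrt_sq hr.le]
  field_simp
  ring

/-- Both components of the rescaled Bessel functions oscillate harmonically up to `O(1/x)`. -/
lemma exists_besselJ_asymptotics : ∃ p q C : ℝ, 0 ≤ C ∧ ∀ x, 1 ≤ x →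
    |√x * besselJ 0 x - (q * Real.cos x + p * Real.sin x)| ≤ C / x ∧
    |√x * besselJ 1 x - (q * Real.sin x - p * Real.cos x)| ≤ C / x := by
  set u : ℝ → ℝ := fun x => √x * besselJ 0 x with hu
  set v : ℝ → ℝ := fun x => besselJ 0 x / (2 * √x) - √x * besselJ 1 x with hv
  have hu' : ∀ x, 1 ≤ x → HasDerivAt u (v x) x := fun x hx =>
    hasDerivAt_sqrt_mul_besselJ_zero (by linarith)
  have hv' : ∀ x, 1 ≤ x → HasDerivAt v (-(1 + 1 / (4 * x ^ 2)) * u x) x := fun x hx =>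
    hasDerivAt_deriv_sqrt_mul_besselJ_zero (by linarith)
  -- The energy of the oscillator decreases because its stiffness does; this bounds `u` on `[1, ∞)`.
  set En : ℝ → ℝ := fun x => v x ^ 2 + (1 + 1 / (4 * x ^ 2)) * u x ^ 2 with hEn
  have hEn' : ∀ x, 1 ≤ x → HasDerivAt En (-(u x ^ 2 / (2 * x ^ 3))) x := fun x hx => by
    have hx0 : x ≠ 0 := by positivity
    have h1 : HasDerivAt (fun x : ℝ => 1 + 1 / (4 * x ^ 2)) (-(1 / (2 * x ^ 3))) x := by
      have := (((hasDerivAt_pow 2 x).const_mul 4).inv (by positivity)).const_add 1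
      simp only [one_div]
      convert! this using 1
      field_simp
      norm_num
      ring
    convert! ((hv' x hx).fun_pow 2).fun_add (h1.fun_mul ((hu' x hx).fun_pow 2)) using 1
    field_simp
    ring
  have hEanti : AntitoneOn En (Set.Ici 1) := by
    refine antitoneOn_of_deriv_nonpos (convex_Ici 1)
      (fun x hx => (hEn' x hx).continuousAt.continuousWithinAt)
      (fun x hx => ?_) fun x hx => ?_ <;> rw [interior_Ici] at hx
    · exact (hEn' x hx.le).differentiableAt.differentiableWithinAt
    · rw [(hEn' x hx.le).deriv]
      have : (0 : ℝ) < x := by linarith [Set.mem_Ioi.1 hx]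
      exact neg_nonpos.2 (by positivity)
  set M := √(En 1) with hM
  have hub : ∀ x, 1 ≤ x → |u x| ≤ M := fun x hx => by
    apply Real.abs_le_sqrt
    refine le_trans ?_ (hEanti Set.self_mem_Ici hx hx)
    have : 0 ≤ 1 / (4 * x ^ 2) * u x ^ 2 := by positivity
    simp only [hEn]
    nlinarith [sq_nonneg (v x)]
  have hM0 : 0 ≤ M := Real.sqrt_nonneg _
  have hbd : ∀ x c, 1 ≤ x → |c| ≤ 1 → |u x * c / (4 * x ^ 2)| ≤ M / 4 / x ^ 2 := fun x c hx hc => by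
    rw [abs_div, abs_mul, abs_of_pos (by positivity : 0 < 4 * x ^ 2), div_div]
    gcongr
    calc |u x| * |c| ≤ M * 1 := by gcongr; exact hub x hx
      _ = M := mul_one M
  -- Variation of constants: the coordinates of `(u, v)` in the frame of the free oscillator have
  -- derivatives of size `u/(4x²)`, so they converge at rate `1/x`.
  obtain ⟨p, hp⟩ := exists_abs_sub_le_div_of_deriv_le (P := fun x => v x * Real.cos x + u x * Real.sin x)
    (P' := fun x => u x * -Real.cos x / (4 * x ^ 2)) (K := M / 4) (by positivity)
    (fun x hx => by
      have hx0 : x ≠ 0 := by positivity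
      convert! ((hv' x hx).mul (Real.hasDerivAt_cos x)).add
        ((hu' x hx).mul (Real.hasDerivAt_sin x)) using 1
      field_simp
      ring)
    (fun x hx => hbd x _ hx (by rw [abs_neg]; exact Real.abs_cos_le_one x))
  obtain ⟨q, hq⟩ := exists_abs_sub_le_div_of_deriv_le (P := fun x => u x * Real.cos x - v x * Real.sin x)
    (P' := fun x => u x * Real.sin x / (4 * x ^ 2)) (K := M / 4) (by positivity)
    (fun x hx => by
      have hx0 : x ≠ 0 := by positivity
      convert! ((hu' x hx).mul (Real.hasDerivAt_cos x)).sub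
        ((hv' x hx).mul (Real.hasDerivAt_sin x)) using 1
      field_simp
      ring)
    (fun x hx => hbd x _ hx (Real.abs_sin_le_one x))
  have hcomb : ∀ a b c d K : ℝ, |a| ≤ K → |b| ≤ K → |c| ≤ 1 → |d| ≤ 1 → |a * c + b * d| ≤ 2 * K := by
    intro a b c d K ha hb hc hd
    have hK : 0 ≤ K := (abs_nonneg a).trans ha
    calc |a * c + b * d| ≤ |a| * |c| + |b| * |d| := by
          rw [← abs_mul, ← abs_mul]; exact abs_add_le _ _
      _ ≤ K * 1 + K * 1 := by gcongr
      _ = 2 * K := by ring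
  refine ⟨p, q, M, hM0, fun x hx => ⟨?_, ?_⟩⟩
  · have h := hcomb _ _ _ _ _ (hq x hx) (hp x hx) (Real.abs_cos_le_one x) (Real.abs_sin_le_one x)
    have e : √x * besselJ 0 x - (q * Real.cos x + p * Real.sin x) =
        (u x * Real.cos x - v x * Real.sin x - q) * Real.cos x +
        (v x * Real.cos x + u x * Real.sin x - p) * Real.sin x := by
      linear_combination (-u x) * Real.sin_sq_add_cos_sq x
    rw [e]
    refine h.trans ?_
    have : 0 ≤ M / x := by positivity
    linarith [show 2 * (M / 4 / x) = M / x / 2 by ring]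
  · have h := hcomb _ _ _ _ _ (hq x hx) (hp x hx) (Real.abs_sin_le_one x)
      (show |-Real.cos x| ≤ 1 by rw [abs_neg]; exact Real.abs_cos_le_one x)
    have hJ : √x * besselJ 1 x = u x / (2 * x) - v x := by
      obtain ⟨r, hr, rfl⟩ : ∃ r : ℝ, 0 < r ∧ x = r ^ 2 := ⟨√x, Real.sqrt_pos.2 (by linarith), by
        rw [Real.sq_sqrt (by linarith)]⟩
      simp only [hu, hv, Real.sqrt_sq hr.le]
      field_simp
      ring
    have e : √x * besselJ 1 x - (q * Real.sin x - p * Real.cos x) = u x / (2 * x) +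
        ((u x * Real.cos x - v x * Real.sin x - q) * Real.sin x +
        (v x * Real.cos x + u x * Real.sin x - p) * -Real.cos x) := by
      rw [hJ]
      linear_combination (v x) * Real.sin_sq_add_cos_sq x
    rw [e]
    have h3 : |u x / (2 * x)| ≤ M / x / 2 := by
      rw [abs_div, abs_of_pos (by positivity : 0 < 2 * x), div_div, mul_comm x 2]
      gcongr
      exact hub x hx
    refine (abs_add_le _ _).trans ?_
    linarith [show 2 * (M / 4 / x) = M / x / 2 by ring]

/-! ### The amplitude `2/π`, from the Laplace transform of `J₀` near its singularity. -/

/-- The Laplace kernel `e^{-(s+i)x}` along the line through the resonance `i` of `J₀`. -/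
noncomputable def resonantKernel (s x : ℝ) : ℂ := Complex.exp (-((s : ℂ) + Complex.I) * x)

lemma norm_resonantKernel (s x : ℝ) : ‖resonantKernel s x‖ = Real.exp (-s * x) := by
  simp [resonantKernel, Complex.norm_exp]

lemma continuous_resonantKernel (s : ℝ) : Continuous (resonantKernel s) := by
  unfold resonantKernel; fun_prop

lemma integrableOn_mul_exp_neg {s : ℝ} (hs : 0 < s) :
    IntegrableOn (fun x : ℝ => x * Real.exp (-s * x)) (Set.Ioi 0) := by
  have := integrableOn_rpow_mul_exp_neg_mul_rpow (p := 1) (s := 1) (b := s) (by norm_num) one_pos hs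
  simpa using this

lemma integrableOn_resonantKernel_mul {s : ℝ} (hs : 0 < s) (n : ℕ) :
    IntegrableOn (fun x => resonantKernel s x * (besselJ n x : ℂ)) (Set.Ioi 0) := by
  refine (integrableOn_exp_mul_Ioi (a := -s) (by linarith) 0).mono'
    ((continuous_resonantKernel s).mul
      (Complex.continuous_ofReal.comp (continuous_besselJ n))).aestronglyMeasurable
    (Eventually.of_forall fun x => ?_)
  rw [norm_mul, norm_resonantKernel, Complex.norm_real, Real.norm_eq_abs]
  exact mul_le_of_le_one_right (Real.exp_pos _).le (abs_besselJ_le_one n x)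

lemma integrableOn_resonantKernel_mul_id_mul {s : ℝ} (hs : 0 < s) (n : ℕ) :
    IntegrableOn (fun x => resonantKernel s x * ((x * besselJ n x : ℝ) : ℂ)) (Set.Ioi 0) := by
  refine (integrableOn_mul_exp_neg hs).mono'
    ((continuous_resonantKernel s).mul
      (Complex.continuous_ofReal.comp
        (continuous_id.mul (continuous_besselJ n)))).aestronglyMeasurable
    ((ae_restrict_iff' measurableSet_Ioi).2 (Eventually.of_forall fun x hx => ?_))
  rw [Set.mem_Ioi] at hx
  rw [norm_mul, norm_resonantKernel, Complex.norm_real, Real.norm_eq_abs, abs_mul, abs_of_pos hx,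
    mul_comm]
  gcongr
  exact mul_le_of_le_one_right hx.le (abs_besselJ_le_one n x)

/-- The Laplace transform of `J₀` at `s + i`. -/
noncomputable def besselLaplace (s : ℝ) : ℂ := ∫ x in Set.Ioi (0 : ℝ), resonantKernel s x * (besselJ 0 x : ℂ)

lemma hasDerivAt_resonantKernel_left (s x : ℝ) :
    HasDerivAt (fun s => resonantKernel s x) (-x * resonantKernel s x) s := by
  have h : HasDerivAt (fun s : ℝ => -((s : ℂ) + Complex.I) * x) (-x) s := by
    have := (((hasDerivAt_id s).ofReal_comp.add_const Complex.I).neg.mul_const (x : ℂ))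
    convert! this using 1
    simp
  convert! h.cexp using 1
  rw [resonantKernel]; ring

lemma hasDerivAt_resonantKernel_right (s x : ℝ) :
    HasDerivAt (resonantKernel s) (-((s : ℂ) + Complex.I) * resonantKernel s x) x := by
  have h : HasDerivAt (fun x : ℝ => -((s : ℂ) + Complex.I) * x) (-((s : ℂ) + Complex.I)) x := by
    have := (hasDerivAt_id x).ofReal_comp.const_mul (-((s : ℂ) + Complex.I))
    convert! this using 1
    simp
  convert! h.cexp using 1
  rw [resonantKernel]; ring

lemma hasDerivAt_besselLaplace {s : ℝ} (hs : 0 < s) :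
    HasDerivAt besselLaplace
      (-∫ x in Set.Ioi (0 : ℝ), resonantKernel s x * ((x * besselJ 0 x : ℝ) : ℂ)) s := by
  have h := hasDerivAt_integral_of_dominated_loc_of_deriv_le
    (μ := volume.restrict (Set.Ioi (0 : ℝ))) (x₀ := s) (s := Set.Ioi (s / 2))
    (F := fun s x => resonantKernel s x * (besselJ 0 x : ℂ))
    (F' := fun s x => -x * resonantKernel s x * (besselJ 0 x : ℂ))
    (bound := fun x => x * Real.exp (-(s / 2) * x))
    (Ioi_mem_nhds (by linarith))
    (Eventually.of_forall fun y => ((continuous_resonantKernel y).mul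
      (Complex.continuous_ofReal.comp (continuous_besselJ 0))).aestronglyMeasurable)
    (integrableOn_resonantKernel_mul hs 0)
    (((Complex.continuous_ofReal.neg.mul (continuous_resonantKernel s)).mul
      (Complex.continuous_ofReal.comp (continuous_besselJ 0))).aestronglyMeasurable)
    ((ae_restrict_iff' measurableSet_Ioi).2 (Eventually.of_forall fun x hx y hy => by
      rw [Set.mem_Ioi] at hx hy
      rw [norm_mul, norm_mul, norm_neg, norm_resonantKernel, Complex.norm_real, Complex.norm_real,
        Real.norm_eq_abs, Real.norm_eq_abs, abs_of_pos hx]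
      calc x * Real.exp (-y * x) * |besselJ 0 x| ≤ x * Real.exp (-y * x) * 1 := by
            gcongr; exact abs_besselJ_le_one 0 x
        _ ≤ x * Real.exp (-(s / 2) * x) := by rw [mul_one]; gcongr))
    (integrableOn_mul_exp_neg (by linarith))
    (Eventually.of_forall fun x y _ => (hasDerivAt_resonantKernel_left y x).mul_const _)
  convert! h.2 using 1
  rw [← integral_neg]
  refine integral_congr_ae (Eventually.of_forall fun x => ?_)
  simp only [Complex.ofReal_mul]
  ring

lemma tendsto_resonantKernel_mul {s : ℝ} (hs : 0 < s) {f : ℝ → ℂ} {C : ℝ}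
    (hf : ∀ x, 0 < x → ‖f x‖ ≤ C * x) :
    Tendsto (fun x => resonantKernel s x * f x) atTop (𝓝 0) := by
  have h0 : Tendsto (fun x : ℝ => C * (x ^ (1 : ℝ) * Real.exp (-s * x))) atTop (𝓝 0) := by
    simpa using (tendsto_rpow_mul_exp_neg_mul_atTop_nhds_zero 1 s hs).const_mul C
  refine squeeze_zero_norm' ((eventually_gt_atTop 0).mono fun x hx => ?_) h0
  rw [norm_mul, norm_resonantKernel, Real.rpow_one]
  calc Real.exp (-s * x) * ‖f x‖ ≤ Real.exp (-s * x) * (C * x) := by gcongr; exact hf x hx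
    _ = _ := by ring

/-- With `P = s + i` and `L` the transform, the integral on the left is `-L'`, so this is `(P² + 1)
L' = -P L`. It follows by integrating the exact derivative of `e^{-Px} (-P x J₀ + x J₁)`, which
vanishes at `0` and at infinity. -/
lemma besselLaplace_ode {s : ℝ} (hs : 0 < s) :
    (((s : ℂ) + Complex.I) ^ 2 + 1) *
      (∫ x in Set.Ioi (0 : ℝ), resonantKernel s x * ((x * besselJ 0 x : ℝ) : ℂ)) =
    ((s : ℂ) + Complex.I) * besselLaplace s := by
  set P : ℂ := (s : ℂ) + Complex.I with hP
  have h := integral_Ioi_of_hasDerivAt_of_tendsto' (a := 0) (m := 0)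
    (f := fun x => resonantKernel s x *
      (-P * ((x * besselJ 0 x : ℝ) : ℂ) + ((x * besselJ 1 x : ℝ) : ℂ)))
    (f' := fun x => (P ^ 2 + 1) * (resonantKernel s x * ((x * besselJ 0 x : ℝ) : ℂ)) -
      P * (resonantKernel s x * (besselJ 0 x : ℂ)))
    (fun x _ => by
      have h1 := hasDerivAt_resonantKernel_right s x
      have h2 := ((hasDerivAt_id x).mul (hasDerivAt_besselJ_zero x)).ofReal_comp.const_mul (-P)
      have h3 := (hasDerivAt_mul_besselJ_one x).ofReal_comp
      convert! h1.mul (h2.add h3) using 1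
      simp only [id, Complex.ofReal_mul, Complex.ofReal_add, Complex.ofReal_neg,
        Complex.ofReal_one, Pi.add_apply, Pi.mul_apply]
      ring)
    (by
      exact Integrable.sub ((integrableOn_resonantKernel_mul_id_mul hs 0).const_mul (P ^ 2 + 1))
        ((integrableOn_resonantKernel_mul hs 0).const_mul P))
    (tendsto_resonantKernel_mul hs (C := ‖P‖ + 1) fun x hx => by
      refine (norm_add_le _ _).trans ?_
      rw [norm_mul, norm_neg, Complex.norm_real, Complex.norm_real, Real.norm_eq_abs,
        Real.norm_eq_abs, abs_mul, abs_mul, abs_of_pos hx, add_mul]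
      have h0 := mul_le_of_le_one_right hx.le (abs_besselJ_le_one 0 x)
      have h1 := mul_le_of_le_one_right hx.le (abs_besselJ_le_one 1 x)
      rw [one_mul]
      gcongr)
  rw [integral_sub ((integrableOn_resonantKernel_mul_id_mul hs 0).const_mul _)
      ((integrableOn_resonantKernel_mul hs 0).const_mul _), integral_const_mul,
      integral_const_mul] at h
  simp only [Complex.ofReal_mul, Complex.ofReal_zero, zero_mul, mul_zero, add_zero, sub_zero] at h
  simp only [Complex.ofReal_mul, besselLaplace]
  exact sub_eq_zero.1 h

/-- Integration by parts with `J₀(0) = 1` and `J₀' = -J₁`. It supplies the normalisation as `s → ∞`,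
where the last integral is `O(1/s)`. -/
lemma mul_besselLaplace {s : ℝ} (hs : 0 < s) :
    ((s : ℂ) + Complex.I) * besselLaplace s =
      1 - ∫ x in Set.Ioi (0 : ℝ), resonantKernel s x * (besselJ 1 x : ℂ) := by
  set P : ℂ := (s : ℂ) + Complex.I with hP
  have h := integral_Ioi_of_hasDerivAt_of_tendsto (a := 0) (m := 0)
    (f := fun x => resonantKernel s x * (besselJ 0 x : ℂ))
    (f' := fun x => -P * (resonantKernel s x * (besselJ 0 x : ℂ)) -
      resonantKernel s x * (besselJ 1 x : ℂ))
    (((continuous_resonantKernel s).mul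
      (Complex.continuous_ofReal.comp (continuous_besselJ 0))).continuousWithinAt)
    (fun x _ => by
      convert! (hasDerivAt_resonantKernel_right s x).mul
        (hasDerivAt_besselJ_zero x).ofReal_comp using 1
      simp only [Complex.ofReal_neg]
      ring)
    (((integrableOn_resonantKernel_mul hs 0).const_mul (-P)).sub
      (integrableOn_resonantKernel_mul hs 1))
    (by
      have h0 : Tendsto (fun x : ℝ => Real.exp (-s * x)) atTop (𝓝 0) := by
        simpa using tendsto_rpow_mul_exp_neg_mul_atTop_nhds_zero 0 s hs
      refine squeeze_zero_norm' (Eventually.of_forall fun x => ?_) h0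
      rw [norm_mul, norm_resonantKernel, Complex.norm_real, Real.norm_eq_abs]
      exact mul_le_of_le_one_right (Real.exp_pos _).le (abs_besselJ_le_one 0 x))
  rw [integral_sub ((integrableOn_resonantKernel_mul hs 0).const_mul _)
      (integrableOn_resonantKernel_mul hs 1), integral_const_mul] at h
  simp only [besselJ_zero_zero, resonantKernel, Complex.ofReal_zero, mul_zero, Complex.exp_zero,
    Complex.ofReal_one, mul_one, zero_sub] at h
  simp only [besselLaplace, resonantKernel]
  linear_combination -h

lemma norm_integral_resonantKernel_le {s : ℝ} (hs : 0 < s) :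
    ‖∫ x in Set.Ioi (0 : ℝ), resonantKernel s x * (besselJ 1 x : ℂ)‖ ≤ 1 / s := by
  have h := norm_integral_le_of_norm_le (μ := volume.restrict (Set.Ioi (0 : ℝ)))
    (f := fun x => resonantKernel s x * (besselJ 1 x : ℂ))
    (integrableOn_exp_mul_Ioi (a := -s) (by linarith) 0) (Eventually.of_forall fun x => by
      rw [norm_mul, norm_resonantKernel, Complex.norm_real, Real.norm_eq_abs]
      exact mul_le_of_le_one_right (Real.exp_pos _).le (abs_besselJ_le_one 1 x))
  rw [integral_exp_mul_Ioi (by linarith)] at h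
  simpa using h

/-- The differential equation makes `L² (P² + 1)` constant in `s`, and `P L → 1` as `s → ∞` gives it
the value `1`. Working with the square avoids choosing a branch of the complex square root. -/
lemma besselLaplace_sq_mul {s : ℝ} (hs : 0 < s) :
    besselLaplace s ^ 2 * (((s : ℂ) + Complex.I) ^ 2 + 1) = 1 := by
  have hder : ∀ x ∈ Set.Ioi (0 : ℝ), HasDerivAt
      (fun s : ℝ => besselLaplace s ^ 2 * (((s : ℂ) + Complex.I) ^ 2 + 1)) 0 x := fun x hx => by
    have h1 := (hasDerivAt_besselLaplace hx).fun_pow 2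
    have h2 := (((hasDerivAt_id x).ofReal_comp.add_const Complex.I).fun_pow 2).add_const 1
    convert! h1.fun_mul h2 using 1
    simp only [id, Complex.ofReal_one]
    linear_combination 2 * besselLaplace x * besselLaplace_ode hx
  have hconst : ∀ x ∈ Set.Ioi (0 : ℝ), besselLaplace x ^ 2 * (((x : ℂ) + Complex.I) ^ 2 + 1) =
      besselLaplace s ^ 2 * (((s : ℂ) + Complex.I) ^ 2 + 1) := fun x hx =>
    (convex_Ioi (0 : ℝ)).is_const_of_fderivWithin_eq_zero (𝕜 := ℝ)
      (fun y hy => (hder y hy).differentiableAt.differentiableWithinAt)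
      (fun y hy => by
        rw [fderivWithin_of_isOpen isOpen_Ioi hy, (hder y hy).hasFDerivAt.fderiv]
        ext; simp) hx hs
  have hinv : Tendsto (fun x : ℝ => ((x : ℂ) + Complex.I)⁻¹) atTop (𝓝 0) := by
    refine squeeze_zero_norm' ((eventually_gt_atTop 0).mono fun x hx => ?_) tendsto_inv_atTop_zero
    rw [norm_inv]
    gcongr
    have := Complex.abs_re_le_norm ((x : ℂ) + Complex.I)
    simp only [Complex.add_re, Complex.ofReal_re, Complex.I_re, add_zero] at this
    exact (le_abs_self x).trans this
  have hone : Tendsto (fun x : ℝ => ((x : ℂ) + Complex.I) * besselLaplace x) atTop (𝓝 1) := by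
    have h0 : Tendsto (fun s : ℝ => ∫ x in Set.Ioi (0 : ℝ),
        resonantKernel s x * (besselJ 1 x : ℂ)) atTop (𝓝 0) :=
      squeeze_zero_norm' ((eventually_gt_atTop 0).mono fun x hx => norm_integral_resonantKernel_le hx)
        (tendsto_inv_atTop_zero.congr fun x => (one_div x).symm)
    have h1 := h0.const_sub 1
    rw [sub_zero] at h1
    exact h1.congr' ((eventually_gt_atTop 0).mono fun x hx => (mul_besselLaplace hx).symm)
  have hlim := (hone.pow 2).mul ((hinv.pow 2).const_add 1)
  simp only [one_pow, ne_eq, OfNat.ofNat_ne_zero, not_false_eq_true, zero_pow, add_zero,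
    mul_one] at hlim
  refine tendsto_nhds_unique (tendsto_const_nhds.congr' ?_) hlim
  filter_upwards [eventually_gt_atTop 0] with x hx
  rw [← hconst x hx]
  have hne : (x : ℂ) + Complex.I ≠ 0 := fun h => by
    have := congrArg Complex.re h
    simp at this
    exact hx.ne' this
  field_simp

lemma integrableOn_exp_neg_div_sqrt :
    IntegrableOn (fun y : ℝ => Real.exp (-y) / √y) (Set.Ioi 0) := by
  refine (Real.GammaIntegral_convergent (s := 1 / 2) (by norm_num)).congr_fun (fun y hy => ?_)
    measurableSet_Ioi
  rw [Set.mem_Ioi] at hy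
  beta_reduce
  rw [Real.sqrt_eq_rpow, div_eq_mul_inv (Real.exp (-y)), ← Real.rpow_neg hy.le]
  norm_num

lemma integral_exp_neg_div_sqrt :
    ∫ y in Set.Ioi (0 : ℝ), Real.exp (-y) / √y = √Real.pi := by
  rw [← Real.Gamma_one_half_eq, Real.Gamma_eq_integral (by norm_num)]
  refine setIntegral_congr_fun measurableSet_Ioi fun y hy => ?_
  rw [Set.mem_Ioi] at hy
  rw [Real.sqrt_eq_rpow, div_eq_mul_inv (Real.exp (-y)), ← Real.rpow_neg hy.le]
  norm_num

/-- Riemann–Lebesgue at Fourier frequency `s⁻¹/π`. No integrability of `w` is required: if it fails,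
the integrals are `0` by convention. -/
lemma tendsto_integral_mul_exp_neg_two_div {w : ℝ → ℝ} :
    Tendsto (fun s : ℝ => ∫ y in Set.Ioi (0 : ℝ), (w y : ℂ) * Complex.exp (-(2 * (y / s) : ℝ) * Complex.I))
      (𝓝[>] 0) (𝓝 0) := by
  have h := (Real.tendsto_integral_exp_smul_cocompact
    ((Set.Ioi (0 : ℝ)).indicator fun y => (w y : ℂ)))
  have h2 : Tendsto (fun s : ℝ => s⁻¹ / Real.pi) (𝓝[>] 0) (cocompact ℝ) :=
    (tendsto_inv_nhdsGT_zero.atTop_div_const Real.pi_pos).mono_right atTop_le_cocompact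
  refine (h.comp h2).congr fun s => ?_
  simp only [Function.comp]
  rw [← integral_indicator measurableSet_Ioi]
  refine integral_congr_ae (Eventually.of_forall fun y => ?_)
  by_cases hy : y ∈ Set.Ioi (0 : ℝ)
  · simp only [Set.indicator_of_mem hy, Circle.smul_def, Real.fourierChar_apply, smul_eq_mul]
    rw [mul_comm]
    congr 2
    push_cast
    have : (Real.pi : ℂ) ≠ 0 := by exact_mod_cast Real.pi_ne_zero
    field_simp
  · simp [Set.indicator_of_notMem hy]

/-- The substitution `x = y/s` moves the limit `s → 0` into the argument of `√x J₀(x)`, against the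
fixed weight `e^{-y}/√y`. -/
lemma sqrt_mul_besselLaplace {s : ℝ} (hs : 0 < s) :
    (√s : ℂ) * besselLaplace s = ∫ y in Set.Ioi (0 : ℝ), ((Real.exp (-y) / √y : ℝ) : ℂ) *
      (Complex.exp (-(y / s : ℝ) * Complex.I) * ((√(y / s) * besselJ 0 (y / s) : ℝ) : ℂ)) := by
  have h := integral_comp_mul_left_Ioi
    (fun x => resonantKernel s x * (besselJ 0 x : ℂ)) 0 (inv_pos.2 hs)
  rw [mul_zero, inv_inv] at h
  have hs0 : √s ≠ 0 := (Real.sqrt_pos.2 hs).ne'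
  have e : (√s : ℂ) * besselLaplace s = (√s : ℂ)⁻¹ * (s • besselLaplace s) := by
    have h1 : (√s : ℂ) ≠ 0 := by exact_mod_cast hs0
    have h2 : (s : ℂ) = √s * √s := by rw [← Complex.ofReal_mul, Real.mul_self_sqrt hs.le]
    rw [Complex.real_smul, eq_inv_mul_iff_mul_eq₀ h1, h2, mul_assoc]
  rw [e, besselLaplace, ← h, ← integral_const_mul]
  refine setIntegral_congr_fun measurableSet_Ioi fun y hy => ?_
  rw [Set.mem_Ioi] at hy
  have hy0 : (√y : ℂ) ≠ 0 := by exact_mod_cast (Real.sqrt_pos.2 hy).ne'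
  have hs1 : (√s : ℂ) ≠ 0 := by exact_mod_cast hs0
  have hs2 : (s : ℂ) ≠ 0 := by exact_mod_cast hs.ne'
  have e2 : resonantKernel s (s⁻¹ * y) =
      Complex.exp (-y) * Complex.exp (-(y / s : ℝ) * Complex.I) := by
    rw [resonantKernel, ← Complex.exp_add]
    congr 1
    push_cast
    field_simp
    ring
  simp only [e2]
  rw [show s⁻¹ * y = y / s by ring, Real.sqrt_div hy.le]
  push_cast
  field_simp

/-- Dominated convergence meets the remainder at every `y/s > 0`, so the estimate on `[1, ∞)` is
completed by the crude bound `√x |J₀| ≤ 1` on `(0, 1]`. -/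
lemma exists_norm_le_of_besselJ_asymptotics {p q C : ℝ} (hC : 0 ≤ C)
    (h : ∀ x, 1 ≤ x → |√x * besselJ 0 x - (q * Real.cos x + p * Real.sin x)| ≤ C / x) :
    ∀ x, 0 < x → |√x * besselJ 0 x - (q * Real.cos x + p * Real.sin x)| ≤ 1 + |q| + |p| + C := by
  intro x hx
  rcases le_total 1 x with h1 | h1
  · refine (h x h1).trans ?_
    have : C / x ≤ C := div_le_self hC h1
    linarith [abs_nonneg q, abs_nonneg p]
  · have e1 : |√x * besselJ 0 x| ≤ 1 := by
      rw [abs_mul, abs_of_nonneg (Real.sqrt_nonneg _)]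
      exact mul_le_one₀ (Real.sqrt_le_one.2 h1) (abs_nonneg _) (abs_besselJ_le_one 0 x)
    have e2 : |q * Real.cos x| ≤ |q| := by
      rw [abs_mul]; exact mul_le_of_le_one_right (abs_nonneg _) (Real.abs_cos_le_one x)
    have e3 : |p * Real.sin x| ≤ |p| := by
      rw [abs_mul]; exact mul_le_of_le_one_right (abs_nonneg _) (Real.abs_sin_le_one x)
    have := abs_sub (√x * besselJ 0 x) (q * Real.cos x + p * Real.sin x)
    have := abs_add_le (q * Real.cos x) (p * Real.sin x)
    linarith

/-- Write `q cos x + p sin x` as `κ e^{ix}` plus its conjugate. The kernel `e^{-ix}` makes the first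
half constant, contributing `κ ∫ e^{-y}/√y = κ√π`. The conjugate half oscillates as `e^{-2iy/s}` and
dies by Riemann–Lebesgue; the remainder dies by dominated convergence. -/
lemma tendsto_sqrt_mul_besselLaplace {p q C : ℝ} (hC : 0 ≤ C)
    (h : ∀ x, 1 ≤ x → |√x * besselJ 0 x - (q * Real.cos x + p * Real.sin x)| ≤ C / x) :
    Tendsto (fun s : ℝ => (√s : ℂ) * besselLaplace s) (𝓝[>] 0)
      (𝓝 (((q - p * Complex.I) / 2) * √Real.pi)) := by
  set κ : ℂ := (q - p * Complex.I) / 2 with hκ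
  set w : ℝ → ℝ := fun y => Real.exp (-y) / √y with hw
  set r : ℝ → ℝ := fun x => √x * besselJ 0 x - (q * Real.cos x + p * Real.sin x) with hr
  have hrc : Continuous r := by fun_prop
  have hrb := exists_norm_le_of_besselJ_asymptotics hC h
  have hr0 : Tendsto r atTop (𝓝 0) := by
    refine squeeze_zero_norm' ((eventually_ge_atTop 1).mono fun x hx => h x hx) ?_
    have := tendsto_inv_atTop_zero.const_mul C
    rw [mul_zero] at this
    exact this.congr fun x => (div_eq_mul_inv C x).symm
  have hwint : IntegrableOn (fun y => (w y : ℂ)) (Set.Ioi 0) := integrableOn_exp_neg_div_sqrt.ofReal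
  have hwnn : ∀ y, 0 ≤ w y := fun y => by positivity
  have hwm : AEStronglyMeasurable (fun y => (w y : ℂ)) (volume.restrict (Set.Ioi 0)) :=
    hwint.aestronglyMeasurable
  have hint2 : ∀ s : ℝ, IntegrableOn (fun y => (w y : ℂ) *
      Complex.exp (-(2 * (y / s) : ℝ) * Complex.I)) (Set.Ioi 0) := fun s => by
    refine integrableOn_exp_neg_div_sqrt.mono' (hwm.mul
      (by apply Continuous.aestronglyMeasurable; fun_prop)) (Eventually.of_forall fun y => ?_)
    rw [norm_mul, Complex.norm_real, ← Complex.ofReal_neg, Complex.norm_exp_ofReal_mul_I, mul_one,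
      Real.norm_of_nonneg (hwnn y)]
  have hnorm3 : ∀ s y : ℝ, 0 < s → y ∈ Set.Ioi (0 : ℝ) → ‖(w y : ℂ) * (Complex.exp (-(y / s : ℝ) * Complex.I) *
      (r (y / s) : ℂ))‖ ≤ w y * (1 + |q| + |p| + C) := fun s y hs hy => by
    rw [norm_mul, norm_mul, Complex.norm_real, ← Complex.ofReal_neg, Complex.norm_exp_ofReal_mul_I,
      one_mul, Real.norm_of_nonneg (hwnn y), Complex.norm_real]
    exact mul_le_mul_of_nonneg_left (hrb _ (div_pos hy hs)) (hwnn y)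
  have hmeas3 : ∀ s : ℝ, AEStronglyMeasurable (fun y => (w y : ℂ) *
      (Complex.exp (-(y / s : ℝ) * Complex.I) * (r (y / s) : ℂ))) (volume.restrict (Set.Ioi 0)) :=
    fun s => hwm.mul (by apply Continuous.aestronglyMeasurable; fun_prop)
  have hint3 : ∀ s : ℝ, 0 < s → IntegrableOn (fun y => (w y : ℂ) *
      (Complex.exp (-(y / s : ℝ) * Complex.I) * (r (y / s) : ℂ))) (Set.Ioi 0) := fun s hs =>
    (integrableOn_exp_neg_div_sqrt.mul_const _).mono' (hmeas3 s)
      ((ae_restrict_iff' measurableSet_Ioi).2 (Eventually.of_forall fun y hy => hnorm3 s y hs hy))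
  have h3 : Tendsto (fun s : ℝ => ∫ y in Set.Ioi (0 : ℝ), (w y : ℂ) *
      (Complex.exp (-(y / s : ℝ) * Complex.I) * (r (y / s) : ℂ))) (𝓝[>] 0) (𝓝 0) := by
    have := tendsto_integral_filter_of_dominated_convergence
      (μ := volume.restrict (Set.Ioi (0 : ℝ))) (l := 𝓝[>] (0 : ℝ)) (f := fun _ => (0 : ℂ))
      (fun y => w y * (1 + |q| + |p| + C)) (Eventually.of_forall hmeas3)
      (eventually_mem_nhdsWithin.mono fun s hs => (ae_restrict_iff' measurableSet_Ioi).2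
        (Eventually.of_forall fun y hy => hnorm3 s y hs hy))
      (integrableOn_exp_neg_div_sqrt.mul_const _)
      ((ae_restrict_iff' measurableSet_Ioi).2 (Eventually.of_forall fun y hy => by
        have hlim : Tendsto (fun s : ℝ => r (y / s)) (𝓝[>] 0) (𝓝 0) :=
          hr0.comp ((tendsto_inv_nhdsGT_zero.const_mul_atTop hy).congr fun s =>
            (div_eq_mul_inv y s).symm)
        have h0 : Tendsto (fun s : ℝ => w y * |r (y / s)|) (𝓝[>] 0) (𝓝 0) := by
          simpa using (hlim.abs.const_mul (w y))
        refine squeeze_zero_norm (fun s => ?_) h0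
        rw [norm_mul, norm_mul, Complex.norm_real, ← Complex.ofReal_neg,
          Complex.norm_exp_ofReal_mul_I, one_mul, Real.norm_of_nonneg (hwnn y), Complex.norm_real,
          Real.norm_eq_abs]))
    simpa using this
  have hsum := ((tendsto_integral_mul_exp_neg_two_div (w := w)).const_mul
    ((q + p * Complex.I) / 2)).add h3
  have hsum' := hsum.const_add (κ * √Real.pi)
  simp only [mul_zero, add_zero] at hsum'
  refine hsum'.congr' ?_
  filter_upwards [self_mem_nhdsWithin] with s hs
  rw [Set.mem_Ioi] at hs
  have hint1 : IntegrableOn (fun y => κ * ((Real.exp (-y) / √y : ℝ) : ℂ)) (Set.Ioi 0) :=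
    hwint.const_mul κ
  have hint23 : IntegrableOn (fun y => (q + p * Complex.I) / 2 *
      ((w y : ℂ) * Complex.exp (-(2 * (y / s) : ℝ) * Complex.I)) +
      (w y : ℂ) * (Complex.exp (-(y / s : ℝ) * Complex.I) * (r (y / s) : ℂ))) (Set.Ioi 0) :=
    ((hint2 s).const_mul _).add (hint3 s hs)
  rw [sqrt_mul_besselLaplace hs, ← integral_exp_neg_div_sqrt, ← integral_complex_ofReal,
    ← integral_const_mul, ← integral_const_mul, ← integral_add ((hint2 s).const_mul _) (hint3 s hs),
    ← integral_add hint1 hint23]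
  refine integral_congr_ae (Eventually.of_forall fun y => ?_)
  have e1 : Complex.exp (-(2 * (y / s) : ℝ) * Complex.I) =
      Complex.exp (-(y / s : ℝ) * Complex.I) * Complex.exp (-(y / s : ℝ) * Complex.I) := by
    rw [← Complex.exp_add]; congr 1; push_cast; ring
  have e2 : Complex.exp (-(y / s : ℝ) * Complex.I) * Complex.exp ((y / s : ℝ) * Complex.I) = 1 := by
    rw [← Complex.exp_add]; simp
  have e3 : ((√(y / s) * besselJ 0 (y / s) : ℝ) : ℂ) = r (y / s) +
      (κ * Complex.exp ((y / s : ℝ) * Complex.I) +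
      (q + p * Complex.I) / 2 * Complex.exp (-(y / s : ℝ) * Complex.I)) := by
    rw [hκ, Complex.exp_mul_I, ← Complex.ofReal_neg, Complex.exp_mul_I, ← Complex.ofReal_cos,
      ← Complex.ofReal_sin, ← Complex.ofReal_cos, ← Complex.ofReal_sin, Real.cos_neg, Real.sin_neg,
      hr]
    push_cast
    ring_nf
    simp only [Complex.I_sq]
    ring
  simp only [e1, e3]
  linear_combination (-(w y : ℂ) * κ) * e2

/-- Since `(s + i)² + 1 = s (s + 2i)`, the closed form gives `s L² = 1/(s + 2i) → 1/(2i)`.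
Comparison with the square of the preceding limit yields `π (q - pi)²/4 = 1/(2i)`. -/
lemma sq_add_sq_of_besselJ_asymptotics {p q C : ℝ} (hC : 0 ≤ C)
    (h : ∀ x, 1 ≤ x → |√x * besselJ 0 x - (q * Real.cos x + p * Real.sin x)| ≤ C / x) :
    q ^ 2 + p ^ 2 = 2 / Real.pi := by
  have h1 := (tendsto_sqrt_mul_besselLaplace hC h).pow 2
  have h2 : Tendsto (fun s : ℝ => ((s : ℂ) + 2 * Complex.I)⁻¹) (𝓝[>] 0) (𝓝 (2 * Complex.I)⁻¹) := by
    have : ContinuousAt (fun s : ℝ => ((s : ℂ) + 2 * Complex.I)⁻¹) 0 := by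
      apply ContinuousAt.inv₀
      · fun_prop
      · simp
    have := this.tendsto.mono_left (nhdsWithin_le_nhds (s := Set.Ioi 0))
    simpa using this
  have h3 := tendsto_nhds_unique (h1.congr' ?_) h2
  -- Only the modulus is kept; the argument would determine the phase modulo `π`, which is not
  -- needed.
  · have h4 := congrArg norm h3
    have e : ‖(q - p * Complex.I : ℂ)‖ ^ 2 = q ^ 2 + p ^ 2 := by
      rw [Complex.sq_norm, Complex.normSq_apply]
      simp
      ring
    rw [norm_pow, norm_mul, norm_div, mul_pow, div_pow, e, norm_inv, Complex.norm_real,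
      Real.norm_of_nonneg (Real.sqrt_nonneg _), Real.sq_sqrt Real.pi_pos.le] at h4
    simp at h4
    have := Real.pi_pos
    field_simp
    linarith
  · filter_upwards [self_mem_nhdsWithin] with s hs
    rw [Set.mem_Ioi] at hs
    have h5 := besselLaplace_sq_mul hs
    have hs0 : (s : ℂ) ≠ 0 := by exact_mod_cast hs.ne'
    have e : ((s : ℂ) + Complex.I) ^ 2 + 1 = s * (s + 2 * Complex.I) := by
      linear_combination Complex.I_sq
    have e2 : (√s : ℂ) ^ 2 = s := by
      rw [← Complex.ofReal_pow, Real.sq_sqrt hs.le]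
    rw [mul_pow, e2]
    refine eq_inv_of_mul_eq_one_left ?_
    rw [e] at h5
    linear_combination h5

/-- Leading asymptotics of `J₀` and `J₁` at infinity, with a common phase `δ`. -/
theorem exists_phase_besselJ : ∃ δ C : ℝ, 0 ≤ C ∧ ∀ x, 1 ≤ x →
    |√x * besselJ 0 x - √(2 / Real.pi) * Real.cos (x - δ)| ≤ C / x ∧
    |√x * besselJ 1 x - √(2 / Real.pi) * Real.sin (x - δ)| ≤ C / x := by
  obtain ⟨p, q, C, hC, h⟩ := exists_besselJ_asymptotics
  have hpq := sq_add_sq_of_besselJ_asymptotics hC fun x hx => (h x hx).1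
  -- Polar form of `q + ip`: its argument is the phase common to `J₀` and `J₁`.
  set z : ℂ := ⟨q, p⟩ with hz
  have hn : ‖z‖ = √(2 / Real.pi) := by
    rw [Complex.norm_def, Complex.normSq_mk, ← hpq]; ring_nf
  have hq : q = √(2 / Real.pi) * Real.cos z.arg := by
    rw [← hn, Complex.norm_mul_cos_arg]
  have hp : p = √(2 / Real.pi) * Real.sin z.arg := by
    rw [← hn, Complex.norm_mul_sin_arg]
  refine ⟨z.arg, C, hC, fun x hx => ?_⟩
  have h1 := h x hx
  rw [Real.cos_sub, Real.sin_sub]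
  constructor
  · convert h1.1 using 3
    linear_combination -Real.cos x * hq - Real.sin x * hp
  · convert h1.2 using 3
    linear_combination -Real.sin x * hq + Real.cos x * hp

/-! ### Locally uniform smallness and weak convergence -/

/-- The family `f lam` tends to zero locally uniformly on `region`. -/
def LocallySmall (f : ℝ → Pt → ℝ) : Prop :=
  ∀ p ∈ region, Tendsto (fun z : ℝ × Pt => f z.1 z.2) (𝓝[>] 0 ×ˢ 𝓝 p) (𝓝 0)

/-- The family `f lam` is locally bounded on `region`, uniformly in small `lam`. -/
def LocallyBdd (f : ℝ → Pt → ℝ) : Prop :=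
  ∀ p ∈ region, (fun z : ℝ × Pt => f z.1 z.2) =O[𝓝[>] 0 ×ˢ 𝓝 p] (fun _ => (1 : ℝ))

lemma isOpen_region : IsOpen region := isOpen_lt continuous_const (continuous_apply 1)

lemma LocallySmall.congr {f g : ℝ → Pt → ℝ} (hf : LocallySmall f)
    (h : ∀ lam > 0, ∀ p ∈ region, f lam p = g lam p) : LocallySmall g := fun p hp =>
  (hf p hp).congr' <| by
    filter_upwards [prod_mem_prod self_mem_nhdsWithin (isOpen_region.mem_nhds hp)] with z hz
    exact h z.1 hz.1 z.2 hz.2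

lemma LocallySmall.zero : LocallySmall fun _ _ => 0 := fun _ _ => tendsto_const_nhds

lemma LocallySmall.add {f g : ℝ → Pt → ℝ} (hf : LocallySmall f) (hg : LocallySmall g) :
    LocallySmall fun lam p => f lam p + g lam p := fun p hp => by
  simpa using (hf p hp).add (hg p hp)

lemma LocallySmall.locallyBdd {f : ℝ → Pt → ℝ} (hf : LocallySmall f) : LocallyBdd f :=
  fun p hp => (hf p hp).isBigO_one ℝ

lemma LocallyBdd.add {f g : ℝ → Pt → ℝ} (hf : LocallyBdd f) (hg : LocallyBdd g) :
    LocallyBdd fun lam p => f lam p + g lam p := fun p hp => (hf p hp).add (hg p hp)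

lemma LocallyBdd.mul {f g : ℝ → Pt → ℝ} (hf : LocallyBdd f) (hg : LocallyBdd g) :
    LocallyBdd fun lam p => f lam p * g lam p := fun p hp => by
  simpa using (hf p hp).mul (hg p hp)

lemma LocallyBdd.sum {ι : Type*} (s : Finset ι) {f : ι → ℝ → Pt → ℝ}
    (hf : ∀ i ∈ s, LocallyBdd (f i)) : LocallyBdd fun lam p => ∑ i ∈ s, f i lam p := fun p hp =>
  Asymptotics.IsBigO.fun_sum fun i hi => hf i hi p hp

lemma LocallySmall.mul_bdd {f g : ℝ → Pt → ℝ} (hf : LocallySmall f) (hg : LocallyBdd g) :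
    LocallySmall fun lam p => f lam p * g lam p := fun p hp => by
  have := ((Asymptotics.isLittleO_one_iff ℝ).2 (hf p hp)).mul_isBigO (hg p hp)
  exact (Asymptotics.isLittleO_one_iff ℝ).1 (by simpa using this)

lemma LocallyBdd.mul_small {f g : ℝ → Pt → ℝ} (hf : LocallyBdd f) (hg : LocallySmall g) :
    LocallySmall fun lam p => f lam p * g lam p := by
  simpa only [mul_comm] using hg.mul_bdd hf

lemma locallyBdd_of_continuousOn {c : Pt → ℝ} (hc : ContinuousOn c region) :
    LocallyBdd fun _ => c := fun _ hp =>
  ((hc.continuousAt (isOpen_region.mem_nhds hp)).tendsto.comp tendsto_snd).isBigO_one ℝ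

lemma locallyBdd_of_abs_le {f : ℝ → Pt → ℝ} {C : ℝ} (h : ∀ lam p, |f lam p| ≤ C) :
    LocallyBdd f := fun _ _ =>
  Asymptotics.isBigO_of_le' (c := C) _ fun z => by simpa using h z.1 z.2

lemma LocallySmall.tendstoLocallyUniformlyOn {f : ℝ → Pt → ℝ} {g : Pt → ℝ}
    (h : LocallySmall fun lam p => f lam p - g p) :
    TendstoLocallyUniformlyOn f g (𝓝[>] 0) region := by
  rw [isOpen_region.tendstoLocallyUniformlyOn_iff_forall_tendsto]
  intro p hp
  rw [Metric.uniformity_eq_comap_nhds_zero, tendsto_comap_iff]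
  have := (h p hp).abs
  rw [abs_zero] at this
  refine this.congr fun z => ?_
  simp only [Function.comp]
  rw [dist_comm, Real.dist_eq]

/-- Compactness glues the product filters at the points of `K` into `𝓝[>] 0 ×ˢ 𝓝ˢ K`, giving a
single threshold in `lam` for all of `K`. -/
lemma LocallySmall.eventually_abs_le {f : ℝ → Pt → ℝ} (hf : LocallySmall f) {K : Set Pt}
    (hK : IsCompact K) (hKr : K ⊆ region) {ε : ℝ} (hε : 0 < ε) :
    ∀ᶠ lam in 𝓝[>] (0 : ℝ), ∀ p ∈ K, |f lam p| ≤ ε := by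
  have h : ∀ᶠ z : ℝ × Pt in 𝓝[>] 0 ×ˢ 𝓝ˢ K, |f z.1 z.2| ≤ ε := by
    rw [hK.prod_nhdsSet_eq_biSup]
    simp only [eventually_iSup]
    intro p hp
    have := (hf p (hKr hp)).abs
    rw [abs_zero] at this
    exact (this.eventually (gt_mem_nhds hε)).mono fun _ h => h.le
  filter_upwards [h.curry] with lam hlam p hp
  exact hlam.self_of_nhdsSet p hp

/-- Weak convergence of scalar components: `∫ g A lam → ∫ g B` for all integrable `g` supported in
a compact subset of `region`. -/
structure WeakConv (A : ℝ → Pt → ℝ) (B : Pt → ℝ) : Prop where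
  cont : ∀ lam > 0, ContinuousOn (A lam) region
  contLim : ContinuousOn B region
  tendsto : ∀ K ⊆ region, IsCompact K → ∀ g : Pt → ℝ, Integrable g → (∀ p ∉ K, g p = 0) →
    Tendsto (fun lam => ∫ p, g p * A lam p) (𝓝[>] 0) (𝓝 (∫ p, g p * B p))

lemma integrable_mul_of_continuousOn {K : Set Pt} (hKr : K ⊆ region) (hK : IsCompact K)
    {g c : Pt → ℝ} (hg : Integrable g) (hg0 : ∀ p ∉ K, g p = 0) (hc : ContinuousOn c region) :
    Integrable fun p => g p * c p := by
  have h : IntegrableOn (fun p => g p * c p) K :=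
    hg.integrableOn.mul_continuousOn (hc.mono hKr) hK
  refine (integrableOn_iff_integrable_of_support_subset fun p hp => ?_).1 h
  by_contra hpK
  exact hp (by simp [hg0 p hpK])

lemma WeakConv.congr {A A' : ℝ → Pt → ℝ} {B B' : Pt → ℝ} (h : WeakConv A B)
    (hA : ∀ lam > 0, ∀ p ∈ region, A lam p = A' lam p) (hB : ∀ p ∈ region, B p = B' p) :
    WeakConv A' B' where
  cont lam hlam := (h.cont lam hlam).congr fun p hp => (hA lam hlam p hp).symm
  contLim := h.contLim.congr fun p hp => (hB p hp).symm
  tendsto K hKr hK g hg hg0 := by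
    have e : ∀ c c' : Pt → ℝ, (∀ p ∈ region, c p = c' p) → ∫ p, g p * c p = ∫ p, g p * c' p :=
      fun c c' hcc => integral_congr_ae (Eventually.of_forall fun p => by
        by_cases hp : p ∈ K
        · simp only [hcc p (hKr hp)]
        · simp [hg0 p hp])
    rw [← e _ _ hB]
    refine (h.tendsto K hKr hK g hg hg0).congr' ?_
    filter_upwards [self_mem_nhdsWithin] with lam hlam
    exact e _ _ (hA lam hlam)

lemma WeakConv.add {A A' : ℝ → Pt → ℝ} {B B' : Pt → ℝ} (h : WeakConv A B) (h' : WeakConv A' B') :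
    WeakConv (fun lam p => A lam p + A' lam p) fun p => B p + B' p where
  cont lam hlam := (h.cont lam hlam).add (h'.cont lam hlam)
  contLim := h.contLim.add h'.contLim
  tendsto K hKr hK g hg hg0 := by
    simp only [mul_add]
    rw [integral_add (integrable_mul_of_continuousOn hKr hK hg hg0 h.contLim)
      (integrable_mul_of_continuousOn hKr hK hg hg0 h'.contLim)]
    refine ((h.tendsto K hKr hK g hg hg0).add (h'.tendsto K hKr hK g hg hg0)).congr' ?_
    filter_upwards [self_mem_nhdsWithin] with lam hlam
    rw [integral_add (integrable_mul_of_continuousOn hKr hK hg hg0 (h.cont lam hlam))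
      (integrable_mul_of_continuousOn hKr hK hg hg0 (h'.cont lam hlam))]

/-- The coefficient is absorbed into the test function, which remains admissible because only
integrability and compact support are asked of it. -/
lemma WeakConv.continuousOn_mul {A : ℝ → Pt → ℝ} {B c : Pt → ℝ} (h : WeakConv A B)
    (hc : ContinuousOn c region) :
    WeakConv (fun lam p => c p * A lam p) fun p => c p * B p where
  cont lam hlam := hc.mul (h.cont lam hlam)
  contLim := hc.mul h.contLim
  tendsto K hKr hK g hg hg0 := by
    simp only [← mul_assoc]
    exact h.tendsto K hKr hK _ (integrable_mul_of_continuousOn hKr hK hg hg0 hc)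
      fun p hp => by simp [hg0 p hp]

lemma WeakConv.const {B : Pt → ℝ} (hB : ContinuousOn B region) : WeakConv (fun _ => B) B :=
  ⟨fun _ _ => hB, hB, fun _ _ _ _ _ _ => tendsto_const_nhds⟩

lemma WeakConv.sum {ι : Type*} (s : Finset ι) {A : ι → ℝ → Pt → ℝ} {B : ι → Pt → ℝ}
    (h : ∀ i ∈ s, WeakConv (A i) (B i)) :
    WeakConv (fun lam p => ∑ i ∈ s, A i lam p) fun p => ∑ i ∈ s, B i p := by
  classical
  induction s using Finset.induction_on with
  | empty => simpa using WeakConv.const continuousOn_const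
  | insert i s hi ih =>
    simp only [Finset.sum_insert hi]
    exact (h i (Finset.mem_insert_self i s)).add
      (ih fun j hj => h j (Finset.mem_insert_of_mem hj))

lemma LocallySmall.weakConv {A : ℝ → Pt → ℝ} (h : LocallySmall A)
    (hc : ∀ lam > 0, ContinuousOn (A lam) region) : WeakConv A fun _ => 0 where
  cont := hc
  contLim := continuousOn_const
  tendsto K hKr hK g hg hg0 := by
    simp only [mul_zero, integral_zero]
    rw [Metric.tendsto_nhds]
    intro ε hε
    have hI : 0 ≤ ∫ p, |g p| := integral_nonneg fun p => abs_nonneg _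
    filter_upwards [h.eventually_abs_le hK hKr
      (ε := ε / (2 * (1 + ∫ p, |g p|))) (by positivity)] with lam hlam
    rw [dist_zero_right]
    calc ‖∫ p, g p * A lam p‖ ≤ ∫ p, |g p| * (ε / (2 * (1 + ∫ p, |g p|))) := by
          refine norm_integral_le_of_norm_le (hg.abs.mul_const _) (Eventually.of_forall fun p => ?_)
          rw [norm_mul, Real.norm_eq_abs, Real.norm_eq_abs]
          by_cases hp : p ∈ K
          · exact mul_le_mul_of_nonneg_left (hlam p hp) (abs_nonneg _)
          · simp [hg0 p hp]
      _ = (∫ p, |g p|) * (ε / (2 * (1 + ∫ p, |g p|))) := integral_mul_const _ _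
      _ ≤ (1 + ∫ p, |g p|) * (ε / (2 * (1 + ∫ p, |g p|))) := by gcongr; linarith
      _ = ε / 2 := by field_simp
      _ < ε := by linarith

/-- Riemann–Lebesgue: a nonresonant oscillation has weak limit zero. -/
lemma weakConv_cos {m n : ℝ} (hmn : m ≠ 0 ∨ n ≠ 0) (θ : ℝ) :
    WeakConv (fun lam p => Real.cos (m * (p 0 / lam) + n * (p 1 / lam) + θ)) fun _ => 0 where
  cont lam _ := by fun_prop
  contLim := continuousOn_const
  tendsto K hKr hK g hg hg0 := by
    simp only [mul_zero, integral_zero]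
    let w : StrongDual ℝ Pt :=
      m • ContinuousLinearMap.proj (R := ℝ) (φ := fun _ : Fin 4 => ℝ) 0 +
        n • ContinuousLinearMap.proj (R := ℝ) (φ := fun _ : Fin 4 => ℝ) 1
    have hwp : ∀ p : Pt, w p = m * p 0 + n * p 1 := fun p => by simp [w]
    have hw : w ≠ 0 := by
      intro h0
      rcases hmn with h | h
      · have := hwp (Pi.single 0 1); rw [h0] at this; simp at this; exact h this.symm
      · have := hwp (Pi.single 1 1); rw [h0] at this; simp at this; exact h this.symm
    -- The phase is `w/lam` with `w ≠ 0`; the factor `1/(2π)` matches the normalisation of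
    -- `Real.fourierChar`, and the frequency leaves every compact set of the dual.
    have hlim : Tendsto (fun lam : ℝ => (-(lam⁻¹ / (2 * Real.pi))) • w) (𝓝[>] 0)
        (cocompact (StrongDual ℝ Pt)) := by
      rw [← Metric.cobounded_eq_cocompact, ← tendsto_norm_atTop_iff_cobounded]
      simp only [norm_smul, norm_neg]
      refine Tendsto.atTop_mul_const (norm_pos_iff.2 hw) ?_
      exact tendsto_norm_atTop_atTop.comp
        (tendsto_inv_nhdsGT_zero.atTop_div_const (by positivity))
    have h := ((tendsto_integral_exp_smul_cocompact (fun p : Pt => (g p : ℂ)) volume).comp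
      hlim).const_mul (Complex.exp (θ * Complex.I))
    rw [mul_zero] at h
    have h2 := (Complex.continuous_re.tendsto 0).comp h
    rw [Complex.zero_re] at h2
    refine h2.congr fun lam => ?_
    simp only [Function.comp]
    have hint : Integrable fun p : Pt => Complex.exp (θ * Complex.I) *
        (Real.fourierChar (-((-(lam⁻¹ / (2 * Real.pi))) • w) p) • (g p : ℂ)) := by
      refine (hg.ofReal (𝕜 := ℂ)).norm.mono' (AEStronglyMeasurable.const_mul ?_ _)
        (Eventually.of_forall fun p => ?_)
      · refine AEStronglyMeasurable.smul ?_ (hg.ofReal (𝕜 := ℂ)).aestronglyMeasurable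
        exact (continuous_subtype_val.comp (Real.continuous_fourierChar.comp
          ((-(lam⁻¹ / (2 * Real.pi))) • w).continuous.neg)).aestronglyMeasurable
      · rw [norm_mul, Complex.norm_exp_ofReal_mul_I, one_mul, Circle.norm_smul]
        exact le_rfl
    rw [← integral_const_mul, ← RCLike.re_eq_complex_re, ← integral_re hint]
    refine integral_congr_ae (Eventually.of_forall fun p => ?_)
    simp only [Circle.smul_def, Real.fourierChar_apply, smul_eq_mul, RCLike.re_eq_complex_re]
    rw [← mul_assoc, ← Complex.exp_add]
    have e : (θ : ℂ) * Complex.I + ↑(2 * Real.pi * -((-(lam⁻¹ / (2 * Real.pi))) • w) p) *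
        Complex.I = ((m * (p 0 / lam) + n * (p 1 / lam) + θ : ℝ) : ℂ) * Complex.I := by
      rw [_root_.smul_apply, smul_eq_mul, hwp]
      rw [← add_mul, ← Complex.ofReal_add]
      congr 2
      have := Real.pi_pos
      field_simp
      ring
    rw [e, Complex.re_mul_ofReal, Complex.exp_ofReal_mul_I_re, mul_comm]

/-! ### Families asymptotic to combinations of plane waves -/

/-- Wave numbers in `ρ`. -/
def waveNum : Fin 4 → ℝ := ![1, 1, 2, 2]

/-- Frequencies in `t`. -/
def waveFreq : Fin 4 → ℝ := ![1, -1, 2, -2]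

/-- The plane waves `cos (X ± s)`, `cos (2X ± 2s)` with `X = ρ/lam - δ`, `s = t/lam`. -/
noncomputable def wave (δ : ℝ) (k : Fin 4) (lam : ℝ) (p : Pt) : ℝ :=
  Real.cos (waveNum k * (p 1 / lam - δ) + waveFreq k * (p 0 / lam))

lemma continuous_wave (δ : ℝ) (k : Fin 4) (lam : ℝ) : Continuous (wave δ k lam) := by
  unfold wave; fun_prop

lemma locallyBdd_wave (δ : ℝ) (k : Fin 4) : LocallyBdd (wave δ k) :=
  locallyBdd_of_abs_le fun _ _ => Real.abs_cos_le_one _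

/-- Product-to-sum formula. The sum phase always oscillates because every `waveNum` is positive; the
difference phase is stationary only for `k = l`, where `δ` cancels as well. -/
lemma weakConv_wave_mul_wave (δ : ℝ) (k l : Fin 4) :
    WeakConv (fun lam p => wave δ k lam p * wave δ l lam p) fun _ => if k = l then 1 / 2 else 0 := by
  have hsum : WeakConv (fun lam p => 1 / 2 * Real.cos ((waveFreq k + waveFreq l) * (p 0 / lam) +
      (waveNum k + waveNum l) * (p 1 / lam) + -(waveNum k + waveNum l) * δ)) fun _ => 1 / 2 * 0 :=
    (weakConv_cos (Or.inr (by fin_cases k <;> fin_cases l <;> norm_num [waveNum])) _).continuousOn_mul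
      continuousOn_const
  have hdiff : WeakConv (fun lam p => 1 / 2 * Real.cos ((waveFreq k - waveFreq l) * (p 0 / lam) +
      (waveNum k - waveNum l) * (p 1 / lam) + -(waveNum k - waveNum l) * δ))
      fun _ => 1 / 2 * (if k = l then 1 else 0) := by
    refine WeakConv.continuousOn_mul ?_ continuousOn_const
    split_ifs with h
    · subst h
      simpa using WeakConv.const continuousOn_const
    · refine weakConv_cos ?_ _
      revert h
      fin_cases k <;> fin_cases l <;> norm_num [waveNum, waveFreq]
  refine (hsum.add hdiff).congr (fun lam _ p _ => ?_) fun p _ => by split_ifs <;> norm_num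
  have e1 : (waveFreq k + waveFreq l) * (p 0 / lam) + (waveNum k + waveNum l) * (p 1 / lam) +
      -(waveNum k + waveNum l) * δ = (waveNum k * (p 1 / lam - δ) + waveFreq k * (p 0 / lam)) +
      (waveNum l * (p 1 / lam - δ) + waveFreq l * (p 0 / lam)) := by ring
  have e2 : (waveFreq k - waveFreq l) * (p 0 / lam) + (waveNum k - waveNum l) * (p 1 / lam) +
      -(waveNum k - waveNum l) * δ = (waveNum k * (p 1 / lam - δ) + waveFreq k * (p 0 / lam)) -
      (waveNum l * (p 1 / lam - δ) + waveFreq l * (p 0 / lam)) := by ring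
  rw [e1, e2, Real.cos_add, Real.cos_sub, wave, wave]
  ring

/-- `D lam` is continuous and equals `∑ C k * wave k` up to a locally small error. -/
structure HasWaveForm (δ : ℝ) (D : ℝ → Pt → ℝ) (C : Fin 4 → Pt → ℝ) : Prop where
  cont : ∀ lam > 0, ContinuousOn (D lam) region
  contCoeff : ∀ k, ContinuousOn (C k) region
  small : LocallySmall fun lam p => D lam p - ∑ k, C k p * wave δ k lam p

namespace HasWaveForm

variable {δ : ℝ} {D D' : ℝ → Pt → ℝ} {C C' : Fin 4 → Pt → ℝ}

lemma congr (h : HasWaveForm δ D C) (hD : ∀ lam > 0, ∀ p ∈ region, D lam p = D' lam p)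
    (hC : ∀ k, ∀ p ∈ region, C k p = C' k p) : HasWaveForm δ D' C' where
  cont lam hlam := (h.cont lam hlam).congr fun p hp => (hD lam hlam p hp).symm
  contCoeff k := (h.contCoeff k).congr fun p hp => (hC k p hp).symm
  small := h.small.congr fun lam hlam p hp => by
    rw [hD lam hlam p hp]
    congr 1
    exact Finset.sum_congr rfl fun k _ => by rw [hC k p hp]

lemma of_small (h : LocallySmall D) (hc : ∀ lam > 0, ContinuousOn (D lam) region) :
    HasWaveForm δ D fun _ _ => 0 :=
  ⟨hc, fun _ => continuousOn_const, by simpa using h⟩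

lemma add (h : HasWaveForm δ D C) (h' : HasWaveForm δ D' C') :
    HasWaveForm δ (fun lam p => D lam p + D' lam p) fun k p => C k p + C' k p where
  cont lam hlam := (h.cont lam hlam).add (h'.cont lam hlam)
  contCoeff k := (h.contCoeff k).add (h'.contCoeff k)
  small := (h.small.add h'.small).congr fun lam _ p _ => by
    simp only [add_mul, Finset.sum_add_distrib]; ring

lemma locallyBdd_main (h : HasWaveForm δ D C) :
    LocallyBdd fun lam p => ∑ k, C k p * wave δ k lam p :=
  LocallyBdd.sum _ fun k _ => (locallyBdd_of_continuousOn (h.contCoeff k)).mul (locallyBdd_wave δ k)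

lemma locallyBdd (h : HasWaveForm δ D C) : LocallyBdd D := fun p hp =>
  ((h.small.locallyBdd.add h.locallyBdd_main) p hp).congr_left fun z => by ring

/-- Multiplication by a locally uniformly convergent family. -/
lemma mul_convergent (h : HasWaveForm δ D C) {c : ℝ → Pt → ℝ} {c₀ : Pt → ℝ}
    (hc : ∀ lam > 0, ContinuousOn (c lam) region) (hc₀ : ContinuousOn c₀ region)
    (hs : LocallySmall fun lam p => c lam p - c₀ p) :
    HasWaveForm δ (fun lam p => c lam p * D lam p) fun k p => c₀ p * C k p where
  cont lam hlam := (hc lam hlam).mul (h.cont lam hlam)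
  contCoeff k := hc₀.mul (h.contCoeff k)
  small := ((hs.mul_bdd h.locallyBdd).add
    ((locallyBdd_of_continuousOn hc₀).mul_small h.small)).congr fun lam _ p _ => by
      simp only [mul_assoc, ← Finset.mul_sum]; ring

lemma continuousOn_mul (h : HasWaveForm δ D C) {c : Pt → ℝ} (hc : ContinuousOn c region) :
    HasWaveForm δ (fun lam p => c p * D lam p) fun k p => c p * C k p :=
  h.mul_convergent (fun _ _ => hc) hc (by simpa using LocallySmall.zero)

/-- Weak limit of a product of two oscillating families. -/
theorem weakConv_mul (h : HasWaveForm δ D C) (h' : HasWaveForm δ D' C') :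
    WeakConv (fun lam p => D lam p * D' lam p) fun p => (∑ k, C k p * C' k p) / 2 := by
  have hmain : WeakConv (fun lam p => ∑ k, ∑ l, C k p * C' l p * (wave δ k lam p * wave δ l lam p))
      fun p => ∑ k, ∑ l, C k p * C' l p * (if k = l then 1 / 2 else 0) :=
    WeakConv.sum _ fun k _ => WeakConv.sum _ fun l _ =>
      (weakConv_wave_mul_wave δ k l).continuousOn_mul ((h.contCoeff k).mul (h'.contCoeff l))
  have hmc : ∀ {D C}, HasWaveForm δ D C → ∀ lam > 0,
      ContinuousOn (fun p => ∑ k, C k p * wave δ k lam p) region := fun h lam _ =>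
    continuousOn_finsetSum _ fun k _ => (h.contCoeff k).mul (continuous_wave δ k lam).continuousOn
  -- Each term of the remainder is a locally small factor times a locally bounded one.
  have hrem : WeakConv (fun lam p => (D lam p - ∑ k, C k p * wave δ k lam p) * D' lam p +
      (∑ k, C k p * wave δ k lam p) * (D' lam p - ∑ k, C' k p * wave δ k lam p)) fun _ => 0 :=
    ((h.small.mul_bdd h'.locallyBdd).add (h.locallyBdd_main.mul_small h'.small)).weakConv
      fun lam hlam => (((h.cont lam hlam).sub (hmc h lam hlam)).mul (h'.cont lam hlam)).add
        ((hmc h lam hlam).mul ((h'.cont lam hlam).sub (hmc h' lam hlam)))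
  refine (hrem.add hmain).congr (fun lam _ p _ => ?_) fun p _ => ?_
  · have : ∑ k, ∑ l, C k p * C' l p * (wave δ k lam p * wave δ l lam p) =
        (∑ k, C k p * wave δ k lam p) * ∑ k, C' k p * wave δ k lam p := by
      rw [Finset.sum_mul_sum]
      exact Finset.sum_congr rfl fun k _ => Finset.sum_congr rfl fun l _ => by ring
    rw [this]; ring
  · simp only [mul_ite, mul_zero, Finset.sum_ite_eq, Finset.mem_univ, if_true, zero_add,
      Finset.sum_div]
    exact Finset.sum_congr rfl fun k _ => by ring

end HasWaveForm

/-! ### From weak convergence of components to weak limits of tensor fields. -/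

lemma measurableSet_fundamentalDomain : MeasurableSet fundamentalDomain := by
  unfold fundamentalDomain
  measurability

/-- A tensor family whose components converge weakly has a weak limit. -/
theorem isWeakLimit_of_components {g : Field2}
    (hg : ContinuousOn (fun p => √|(g p).det|) region) {n : ℕ} {A : ℝ → TensorField n}
    {B : TensorField n} (h : ∀ i, WeakConv (fun lam p => A lam p i) fun p => B p i) :
    IsWeakLimit g A B := by
  intro f hf
  obtain ⟨r, R, hr, hsupp⟩ := hf.support
  set K : Set Pt := Set.Icc ![-R, r, 0, -R] ![R, R, 2 * Real.pi, R] with hK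
  have hKc : IsCompact K := isCompact_Icc
  have hKr : K ⊆ region := fun p hp => lt_of_lt_of_le hr (hp.1 1)
  -- The cut to one period makes this weight discontinuous in general, which is why `WeakConv`
  -- admits all integrable weights with compact support.
  set G : (Fin n → Fin 4) → Pt → ℝ := fun i =>
    fundamentalDomain.indicator fun p => f p i * √|(g p).det| with hG
  have hmem : ∀ i p, p ∈ fundamentalDomain → f p i ≠ 0 → p ∈ K := fun i p hp hne => by
    obtain ⟨h1, h2, h3, h4⟩ := hsupp p i hne
    rw [abs_le] at h3 h4
    constructor <;> intro j <;> fin_cases j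
    exacts [h3.1, h1, hp.2.1, h4.1, h3.2, h2, hp.2.2.le, h4.2]
  have hG0 : ∀ i, ∀ p ∉ K, G i p = 0 := fun i p hp => by
    by_cases hpF : p ∈ fundamentalDomain
    · rw [hG]; simp only [Set.indicator_of_mem hpF]
      by_contra hne
      exact hp (hmem i p hpF (left_ne_zero_of_mul hne))
    · exact Set.indicator_of_notMem hpF _
  have hGi : ∀ i, Integrable (G i) := fun i => by
    have h1 : IntegrableOn (fun p => f p i * √|(g p).det|) K :=
      (((hf.smooth i).continuous.continuousOn).mul (hg.mono hKr)).integrableOn_compact hKc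
    refine (integrableOn_iff_integrable_of_support_subset (s := K) fun p hp => ?_).1
      (h1.indicator measurableSet_fundamentalDomain)
    by_contra hpK
    exact hp (hG0 i p hpK)
  have hpair : ∀ c : TensorField n, (fundamentalDomain.indicator (pairing g f c)) =
      fun p => ∑ i, G i p * c p i := fun c => by
    ext p
    by_cases hp : p ∈ fundamentalDomain
    · simp only [hG, Set.indicator_of_mem hp, pairing, Finset.sum_mul]
      exact Finset.sum_congr rfl fun i _ => by ring
    · simp [hG, Set.indicator_of_notMem hp]
  have hint : ∀ c : TensorField n, (∀ i, ContinuousOn (fun p => c p i) region) →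
      ∀ i, Integrable fun p => G i p * c p i := fun c hc i =>
    integrable_mul_of_continuousOn hKr hKc (hGi i) (hG0 i) (hc i)
  have hon : ∀ c : TensorField n, (∀ i, ContinuousOn (fun p => c p i) region) →
      IntegrableOn (pairing g f c) fundamentalDomain := fun c hc => by
    rw [← integrable_indicator_iff measurableSet_fundamentalDomain, hpair]
    exact integrable_finsetSum _ fun i _ => hint c hc i
  have heq : ∀ c : TensorField n, (∀ i, ContinuousOn (fun p => c p i) region) →
      ∫ p in fundamentalDomain, pairing g f c p = ∑ i, ∫ p, G i p * c p i := fun c hc => by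
    rw [← integral_indicator measurableSet_fundamentalDomain, hpair,
      integral_finsetSum _ fun i _ => hint c hc i]
  refine ⟨fun lam hlam => hon _ fun i => (h i).cont lam hlam, hon _ fun i => (h i).contLim, ?_⟩
  rw [heq B fun i => (h i).contLim]
  refine (tendsto_finsetSum _ fun i _ =>
    (h i).tendsto K hKr hKc (G i) (hGi i) (hG0 i)).congr' ?_
  filter_upwards [self_mem_nhdsWithin] with lam hlam
  exact (heq (A lam) fun i => (h i).cont lam hlam).symm

/-! ### Geometry of the background -/

lemma inv_diagonal_of_ne_zero {v : Fin 4 → ℝ} (hv : ∀ i, v i ≠ 0) :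
    (Matrix.diagonal v)⁻¹ = Matrix.diagonal fun i => (v i)⁻¹ := by
  refine Matrix.inv_eq_right_inv ?_
  rw [Matrix.diagonal_mul_diagonal, ← Matrix.diagonal_one]
  congr 1
  ext i
  exact mul_inv_cancel₀ (hv i)

lemma pd_radial (i : Fin 4) (F : ℝ → ℝ) (p : Pt) :
    pd i (fun q => F (q 1)) p = if i = 1 then deriv F (p 1) else 0 := by
  unfold pd
  split_ifs with h
  · subst h; simp
  · simp [Function.update_of_ne (Ne.symm h)]

lemma update_mem_region {p : Pt} (hp : p ∈ region) (i : Fin 4) :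
    ∀ᶠ s in 𝓝 (p i), Function.update p i s ∈ region := by
  have hc : Continuous fun s : ℝ => Function.update p i s :=
    continuous_const.update i continuous_id
  exact hc.continuousAt.eventually_mem (by simpa using isOpen_region.mem_nhds hp)

/-- The region is open, so formulas valid only for `ρ > 0` may be differentiated there. -/
lemma pd_congr_region {f f' : Pt → ℝ} {p : Pt} (hp : p ∈ region) (i : Fin 4)
    (h : ∀ q ∈ region, f q = f' q) : pd i f p = pd i f' p := by
  refine Filter.EventuallyEq.deriv_eq ?_
  filter_upwards [update_mem_region hp i] with s hs
  exact h _ hs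

/-- The rate `(α² + β²)/π` in the exponent of the background. -/
noncomputable def bgRate (α β : ℝ) : ℝ := (α ^ 2 + β ^ 2) / Real.pi

/-- Diagonal entries of the background as functions of `ρ`. -/
noncomputable def bgDiag (k : ℝ) (i : Fin 4) (ρ : ℝ) : ℝ :=
  ![-Real.exp (2 * k * ρ), Real.exp (2 * k * ρ), ρ ^ 2, 1] i

/-- Their derivatives. -/
noncomputable def bgDiagDeriv (k : ℝ) (i : Fin 4) (ρ : ℝ) : ℝ :=
  ![-(2 * k * Real.exp (2 * k * ρ)), 2 * k * Real.exp (2 * k * ρ), 2 * ρ, 0] i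

/-- Christoffel symbols of the background. -/
noncomputable def bgGamma (k : ℝ) (c a b : Fin 4) (ρ : ℝ) : ℝ :=
  if c = 0 ∧ (a = 0 ∧ b = 1 ∨ a = 1 ∧ b = 0) ∨ c = 1 ∧ (a = 0 ∧ b = 0 ∨ a = 1 ∧ b = 1) then k
  else if c = 1 ∧ a = 2 ∧ b = 2 then -(ρ * Real.exp (-(2 * k * ρ)))
  else if c = 2 ∧ (a = 1 ∧ b = 2 ∨ a = 2 ∧ b = 1) then ρ⁻¹ else 0

/-- Derivatives of the Christoffel symbols of the background. -/
noncomputable def bgGammaDeriv (k : ℝ) (c a b : Fin 4) (ρ : ℝ) : ℝ :=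
  if c = 1 ∧ a = 2 ∧ b = 2 then (2 * k * ρ - 1) * Real.exp (-(2 * k * ρ))
  else if c = 2 ∧ (a = 1 ∧ b = 2 ∨ a = 2 ∧ b = 1) then -(ρ ^ 2)⁻¹ else 0

lemma background_eq (α β : ℝ) (p : Pt) :
    background α β p = Matrix.diagonal fun i => bgDiag (bgRate α β) i (p 1) := by
  unfold background
  congr 1
  ext i
  have : 2 * (α ^ 2 + β ^ 2) * p 1 / Real.pi = 2 * bgRate α β * p 1 := by rw [bgRate]; ring
  fin_cases i <;> simp [bgDiag, this]

lemma bgDiag_ne_zero (k : ℝ) {ρ : ℝ} (hρ : 0 < ρ) (i : Fin 4) : bgDiag k i ρ ≠ 0 := by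
  fin_cases i <;> simp [bgDiag, hρ.ne']

lemma background_inv (α β : ℝ) {p : Pt} (hp : p ∈ region) :
    (background α β p)⁻¹ = Matrix.diagonal fun i => (bgDiag (bgRate α β) i (p 1))⁻¹ := by
  rw [background_eq, inv_diagonal_of_ne_zero (bgDiag_ne_zero _ hp)]

lemma hasDerivAt_bgDiag (k : ℝ) (i : Fin 4) (ρ : ℝ) :
    HasDerivAt (bgDiag k i) (bgDiagDeriv k i ρ) ρ := by
  have h : HasDerivAt (fun ρ => Real.exp (2 * k * ρ)) (2 * k * Real.exp (2 * k * ρ)) ρ := by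
    convert! ((hasDerivAt_id ρ).const_mul (2 * k)).exp using 1
    simp only [id]; ring
  fin_cases i
  · exact h.neg
  · exact h
  · simpa [bgDiag, bgDiagDeriv] using! hasDerivAt_pow 2 ρ
  · exact hasDerivAt_const ρ (1 : ℝ)

lemma pd_background (α β : ℝ) (i a b : Fin 4) (p : Pt) :
    pd i (fun q => background α β q a b) p =
      if i = 1 ∧ a = b then bgDiagDeriv (bgRate α β) a (p 1) else 0 := by
  simp only [background_eq]
  by_cases hab : a = b
  · subst hab
    simp only [Matrix.diagonal_apply_eq, and_true]
    rw [pd_radial i (bgDiag (bgRate α β) a), (hasDerivAt_bgDiag _ _ _).deriv]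
  · simp [hab, pd]

lemma christoffel_background (α β : ℝ) (c a b : Fin 4) {p : Pt} (hp : p ∈ region) :
    christoffel (background α β) c a b p = bgGamma (bgRate α β) c a b (p 1) := by
  unfold christoffel
  simp only [background_inv α β hp, pd_background]
  rw [Finset.sum_eq_single c (fun d _ hd => by rw [Matrix.diagonal_apply_ne _ hd.symm, zero_mul])
    (by simp), Matrix.diagonal_apply_eq]
  have hρ : p 1 ≠ 0 := ne_of_gt hp
  have he := Real.exp_ne_zero (2 * bgRate α β * p 1)
  fin_cases c <;> fin_cases a <;> fin_cases b <;>
    simp [bgDiag, bgDiagDeriv, bgGamma, Real.exp_neg] <;> field_simp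

lemma hasDerivAt_bgGamma (k : ℝ) (c a b : Fin 4) {ρ : ℝ} (hρ : ρ ≠ 0) :
    HasDerivAt (bgGamma k c a b) (bgGammaDeriv k c a b ρ) ρ := by
  have h1 : HasDerivAt (fun ρ => -(ρ * Real.exp (-(2 * k * ρ))))
      ((2 * k * ρ - 1) * Real.exp (-(2 * k * ρ))) ρ := by
    convert! ((hasDerivAt_id ρ).mul ((hasDerivAt_id ρ).const_mul (2 * k)).fun_neg.exp).neg using 1
    simp only [id]; ring
  unfold bgGamma bgGammaDeriv
  by_cases hA : c = 0 ∧ (a = 0 ∧ b = 1 ∨ a = 1 ∧ b = 0) ∨ c = 1 ∧ (a = 0 ∧ b = 0 ∨ a = 1 ∧ b = 1)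
  · have hB : ¬(c = 1 ∧ a = 2 ∧ b = 2) := by omega
    have hC : ¬(c = 2 ∧ (a = 1 ∧ b = 2 ∨ a = 2 ∧ b = 1)) := by omega
    simp only [if_pos hA, if_neg hB, if_neg hC]
    exact hasDerivAt_const ρ k
  · simp only [if_neg hA]
    split_ifs
    · exact h1
    · exact hasDerivAt_inv hρ
    · exact hasDerivAt_const ρ 0

lemma pd_christoffel_background (α β : ℝ) (i c a b : Fin 4) {p : Pt} (hp : p ∈ region) :
    pd i (christoffel (background α β) c a b) p =
      if i = 1 then bgGammaDeriv (bgRate α β) c a b (p 1) else 0 := by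
  rw [pd_congr_region hp i fun q hq => christoffel_background α β c a b hq,
    pd_radial i (bgGamma (bgRate α β) c a b), (hasDerivAt_bgGamma _ c a b (ne_of_gt hp)).deriv]

/-- The exponent is linear in `ρ`, so the Christoffel symbols of the `(t, ρ)` block are constant;
the surviving curvature comes from their products with `Γ^φ_{ρφ} = 1/ρ`. -/
lemma ricci_background (α β : ℝ) {p : Pt} (hp : p ∈ region) (a b : Fin 4) :
    ricci (background α β) p a b =
      if a = b ∧ (a = 0 ∨ a = 1) then bgRate α β / p 1 else 0 := by
  unfold ricci
  simp only [christoffel_background α β _ _ _ hp, pd_christoffel_background α β _ _ _ _ hp,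
    Fin.sum_univ_four]
  have hρ : p 1 ≠ 0 := ne_of_gt hp
  fin_cases a <;> fin_cases b <;> simp [bgGamma, bgGammaDeriv] <;> field_simp <;> ring

/-- The two nonzero Ricci components are equal while `g^{tt} = -g^{ρρ}`, so they cancel in the
trace. -/
lemma scalarCurvature_background (α β : ℝ) {p : Pt} (hp : p ∈ region) :
    scalarCurvature (background α β) p = 0 := by
  unfold scalarCurvature
  simp only [ricci_background α β hp, background_inv α β hp, Fin.sum_univ_four]
  simp [bgDiag]

lemma einstein_background (α β : ℝ) {p : Pt} (hp : p ∈ region) (a b : Fin 4) :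
    einstein (background α β) p a b =
      if a = b ∧ (a = 0 ∨ a = 1) then (α ^ 2 + β ^ 2) / (Real.pi * p 1) else 0 := by
  rw [einstein, scalarCurvature_background α β hp, ricci_background α β hp, bgRate, div_div]
  ring

lemma effectiveStress_eq (α β : ℝ) {p : Pt} (hp : p ∈ region) (a b : Fin 4) :
    effectiveStress α β p a b =
      if a = b ∧ (a = 0 ∨ a = 1) then β ^ 2 / (8 * Real.pi ^ 2 * p 1) else 0 := by
  rw [effectiveStress, einstein_background α β hp, weakStress]
  have hρ : p 1 ≠ 0 := ne_of_gt hp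
  have := Real.pi_ne_zero
  split_ifs
  · field_simp; ring
  · simp

lemma trace_effectiveStress (α β : ℝ) {p : Pt} (hp : p ∈ region) :
    trace (background α β) (effectiveStress α β) p = 0 := by
  unfold trace
  simp only [effectiveStress_eq α β hp, background_inv α β hp, Fin.sum_univ_four]
  simp [bgDiag]

/-- The quadratic form is a nonnegative multiple of `(v^t)² + (v^ρ)²`. -/
lemma weakEnergyAt_effectiveStress (α β : ℝ) {p : Pt} (hp : p ∈ region) :
    WeakEnergyAt (background α β) (effectiveStress α β) p := by
  intro v _
  simp only [effectiveStress_eq α β hp, Fin.sum_univ_four]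
  have hρ : 0 < p 1 := hp
  have hpi := Real.pi_pos
  have : 0 ≤ β ^ 2 / (8 * Real.pi ^ 2 * p 1) * (v 0 * v 0 + v 1 * v 1) :=
    mul_nonneg (by positivity) (by nlinarith [sq_nonneg (v 0), sq_nonneg (v 1)])
  simp
  linarith

/-! ### The tensor `μ` -/

lemma muTable_symm (α β : ℝ) (p : Pt) (c e : Fin 4) :
    muTable α β p c e = muTable α β p e c := by
  fin_cases c <;> fin_cases e <;> simp [muTable]

lemma mu_apply (α β : ℝ) (p : Pt) (a b c d e f : Fin 4) :
    mu α β p ![a, b, c, d, e, f] =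
      if a = b ∧ (a = 0 ∨ a = 1) ∧ c = d ∧ e = f then muTable α β p c e else 0 := rfl

lemma mu_symmetries (α β : ℝ) (p : Pt) (a b c d e f : Fin 4) :
    mu α β p ![a, b, c, d, e, f] = mu α β p ![b, a, c, d, e, f] ∧
    mu α β p ![a, b, c, d, e, f] = mu α β p ![a, b, d, c, e, f] ∧
    mu α β p ![a, b, c, d, e, f] = mu α β p ![a, b, c, d, f, e] ∧
    mu α β p ![a, b, c, d, e, f] = mu α β p ![a, b, e, f, c, d] := by
  simp only [mu_apply]
  refine ⟨?_, ?_, ?_, ?_⟩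
  · by_cases h : a = b
    · subst h; rfl
    · simp [h, Ne.symm h]
  · by_cases h : c = d
    · subst h; rfl
    · simp [h, Ne.symm h]
  · by_cases h : e = f
    · subst h; rfl
    · simp [h, Ne.symm h]
  · rw [muTable_symm α β p e c]
    congr 1
    apply propext; tauto

lemma contDiffOn_muTable (α β : ℝ) (c e : Fin 4) :
    ContDiffOn ℝ ∞ (fun p => muTable α β p c e) region := by
  have hρ : ContDiffOn ℝ ∞ (fun p : Pt => p 1) region := (contDiff_apply ℝ ℝ 1).contDiffOn
  have hinv : ContDiffOn ℝ ∞ (fun p : Pt => (p 1)⁻¹) region :=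
    hρ.inv fun p hp => ne_of_gt hp
  have hE : ∀ x : ℝ, ContDiffOn ℝ ∞ (fun p : Pt => Real.exp (x * p 1 / Real.pi)) region :=
    fun x => ((contDiffOn_const.mul hρ).div_const _).exp
  fin_cases c <;> fin_cases e <;> simp only [muTable] <;> simp <;> fun_prop

lemma contDiffOn_mu (α β : ℝ) (i : Fin 6 → Fin 4) :
    ContDiffOn ℝ ∞ (fun p => mu α β p i) region := by
  unfold mu
  split_ifs
  · exact contDiffOn_muTable α β _ _
  · exact contDiffOn_const

/-! ### The Green–Wald formula -/

lemma sum_diagonal_mul (w : Fin 4 → ℝ) (F : Fin 4 → Fin 4 → ℝ) :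
    ∑ c, ∑ c', Matrix.diagonal w c c' * F c c' = ∑ c, w c * F c c := by
  refine Finset.sum_congr rfl fun c _ => ?_
  rw [Finset.sum_eq_single c (fun d _ hd => by rw [Matrix.diagonal_apply_ne _ hd.symm, zero_mul])
    (by simp), Matrix.diagonal_apply_eq]

lemma sum_diagonal_mul₂ (w : Fin 4 → ℝ) (F : Fin 4 → Fin 4 → Fin 4 → Fin 4 → ℝ) :
    ∑ c, ∑ c', ∑ d, ∑ d', Matrix.diagonal w c c' * Matrix.diagonal w d d' * F c c' d d' =
      ∑ c, ∑ d, w c * w d * F c c d d := by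
  simp only [mul_assoc, ← Finset.mul_sum, sum_diagonal_mul]

lemma sum_diagonal_mul₃ (w : Fin 4 → ℝ)
    (F : Fin 4 → Fin 4 → Fin 4 → Fin 4 → Fin 4 → Fin 4 → ℝ) :
    ∑ c, ∑ c', ∑ d, ∑ d', ∑ e, ∑ e', Matrix.diagonal w c c' * Matrix.diagonal w d d' *
        Matrix.diagonal w e e' * F c c' d d' e e' =
      ∑ c, ∑ d, ∑ e, w c * w d * w e * F c c d d e e := by
  simp only [mul_assoc, ← Finset.mul_sum, sum_diagonal_mul]

/-- The components of `μ` in terms of the exponential `e^{2kρ}`. -/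
lemma muTable_eq (α β : ℝ) (p : Pt) : muTable α β p =
    let e := Real.exp (2 * bgRate α β * p 1)
    let s := 2 / Real.pi * β ^ 2
    let K := (s * (p 1)⁻¹ + bgRate α β ^ 2) * e ^ 2
    !![K, -K, -(s * p 1 * e), s * (p 1)⁻¹ * e;
       -K, K, s * p 1 * e, -(s * (p 1)⁻¹ * e);
       -(s * p 1 * e), s * p 1 * e, s * p 1 ^ 3, -(s * p 1);
       s * (p 1)⁻¹ * e, -(s * (p 1)⁻¹ * e), -(s * p 1), s * (p 1)⁻¹] := by
  have h1 : 2 * (α ^ 2 + β ^ 2) * p 1 / Real.pi = 2 * bgRate α β * p 1 := by rw [bgRate]; ring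
  have h2 : Real.exp (4 * (α ^ 2 + β ^ 2) * p 1 / Real.pi) =
      Real.exp (2 * bgRate α β * p 1) ^ 2 := by
    rw [← Real.exp_nat_mul, bgRate]; congr 1; push_cast; ring
  have h3 : 1 / Real.pi ^ 2 * (α ^ 2 + β ^ 2) ^ 2 = bgRate α β ^ 2 := by
    rw [bgRate, div_pow]; ring
  simp only [muTable, h1, h2, h3]

/-- The inverse metric is diagonal, so each contraction becomes a single sum and the sixteen
components can be checked directly. The terms in `(α² + β²)²` coming from `∂γ ∂γ` cancel, leaving a
multiple of `β²`. -/
lemma greenWald_mu (α β : ℝ) {p : Pt} (hp : p ∈ region) (a b : Fin 4) :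
    greenWald (background α β) (mu α β) p a b =
      if a = b ∧ (a = 0 ∨ a = 1) then β ^ 2 / (Real.pi * p 1) else 0 := by
  have hρ : p 1 ≠ 0 := ne_of_gt hp
  have he := Real.exp_ne_zero (2 * bgRate α β * p 1)
  unfold greenWald
  rw [background_inv α β hp, sum_diagonal_mul₃, sum_diagonal_mul₂]
  simp only [mu_apply, true_and, and_true, and_self]
  have hw0 : (bgDiag (bgRate α β) 0 (p 1))⁻¹ = -(Real.exp (2 * bgRate α β * p 1))⁻¹ := by
    simp [bgDiag, inv_neg]
  have hw1 : (bgDiag (bgRate α β) 1 (p 1))⁻¹ = (Real.exp (2 * bgRate α β * p 1))⁻¹ := by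
    simp [bgDiag]
  have hw2 : (bgDiag (bgRate α β) 2 (p 1))⁻¹ = (p 1 ^ 2)⁻¹ := by simp [bgDiag]
  have hw3 : (bgDiag (bgRate α β) 3 (p 1))⁻¹ = 1 := by simp [bgDiag]
  -- The bracket multiplying `g_{ab}` vanishes identically.
  have hS : ∑ c : Fin 4, ∑ d : Fin 4, ∑ e : Fin 4, (bgDiag (bgRate α β) c (p 1))⁻¹ *
      (bgDiag (bgRate α β) d (p 1))⁻¹ * (bgDiag (bgRate α β) e (p 1))⁻¹ *
      (-(if (c = 0 ∨ c = 1) ∧ d = e then muTable α β p d d else 0) -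
        (if c = 0 ∨ c = 1 then muTable α β p d e else 0) +
        2 * (if c = d ∧ (c = 0 ∨ c = 1) ∧ c = e ∧ d = e then muTable α β p c d else 0)) = 0 := by
    simp only [Fin.sum_univ_four, hw0, hw1, hw2, hw3]
    simp
    simp [muTable_eq]
    field_simp
    ring
  rw [hS]
  have hpi := Real.pi_ne_zero
  simp only [Fin.sum_univ_four, hw0, hw1, hw2, hw3]
  fin_cases a <;> fin_cases b <;> simp <;> simp [muTable_eq] <;> field_simp <;> ring

/-! ### Derivatives of the metric functions -/

/-- Partial derivatives of `ψ` (and of `φ`). -/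
noncomputable def psiDeriv (b lam : ℝ) (i : Fin 4) (p : Pt) : ℝ :=
  ![b * √lam / lam * besselJ 0 (p 1 / lam) * Real.cos (p 0 / lam),
    -(b * √lam / lam * besselJ 1 (p 1 / lam) * Real.sin (p 0 / lam)), 0, 0] i

/-- Partial derivatives of `γ`. -/
noncomputable def gamDeriv (α β lam : ℝ) (i : Fin 4) (p : Pt) : ℝ :=
  ![-(2 * (α ^ 2 + β ^ 2) * p 1 / lam * besselJ 0 (p 1 / lam) * besselJ 1 (p 1 / lam) *
      Real.sin (p 0 / lam) * Real.cos (p 0 / lam)),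
    (α ^ 2 + β ^ 2) * p 1 / lam * ((besselJ 1 (p 1 / lam) * Real.sin (p 0 / lam)) ^ 2 +
      (besselJ 0 (p 1 / lam) * Real.cos (p 0 / lam)) ^ 2), 0, 0] i

lemma hasDerivAt_div_const (lam x : ℝ) : HasDerivAt (fun s : ℝ => s / lam) (1 / lam) x :=
  (hasDerivAt_id x).div_const lam

lemma hasDerivAt_psi (b lam : ℝ) (i : Fin 4) (p : Pt) :
    HasDerivAt (fun s => psi b lam (Function.update p i s)) (psiDeriv b lam i p) (p i) := by
  unfold psi waveF
  fin_cases i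
  · have h := ((hasDerivAt_div_const lam (p 0)).sin.const_mul
      (besselJ 0 (p 1 / lam))).const_mul (b * √lam)
    convert! h using 1
    · simp [psiDeriv]; ring
  · have h := (((hasDerivAt_besselJ_zero (p 1 / lam)).comp (p 1)
      (hasDerivAt_div_const lam (p 1))).mul_const (Real.sin (p 0 / lam))).const_mul (b * √lam)
    convert! h using 1
    · simp [psiDeriv]; ring
  · simpa [psiDeriv] using hasDerivAt_const (p 2) _
  · simpa [psiDeriv] using hasDerivAt_const (p 3) _

/-- The values in `gamDeriv` are the Einstein–Rosen equations `γ_t = 2ρ (φ_t φ_ρ + ψ_t ψ_ρ)` and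
`γ_ρ = ρ (φ_t² + φ_ρ² + ψ_t² + ψ_ρ²)`: quadratic in the fields, hence waves at doubled frequency. -/
lemma hasDerivAt_gam (α β : ℝ) {lam : ℝ} (hlam : 0 < lam) (i : Fin 4) {p : Pt} (hp : p ∈ region) :
    HasDerivAt (fun s => gam α β lam (Function.update p i s)) (gamDeriv α β lam i p) (p i) := by
  unfold gam
  have hρ : p 1 ≠ 0 := ne_of_gt hp
  have hl := hlam.ne'
  fin_cases i
  · have h := ((((hasDerivAt_div_const lam (p 0)).sin.fun_pow 2).const_mul
      (2 * (lam / p 1) * besselJ 0 (p 1 / lam) * besselJ 1 (p 1 / lam))).const_sub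
      (besselJ 0 (p 1 / lam) ^ 2 + besselJ 1 (p 1 / lam) ^ 2)).const_mul
      ((α ^ 2 + β ^ 2) / (2 * lam) * p 1 ^ 2)
    convert! h using 1
    · simp [gamDeriv]; field_simp
  · have hd := hasDerivAt_div_const lam (p 1)
    have h0 := (hasDerivAt_besselJ_zero (p 1 / lam)).comp (p 1) hd
    have h1 := (hasDerivAt_besselJ_one (div_ne_zero hρ hl)).comp (p 1) hd
    have hq := (hasDerivAt_const (p 1) lam).fun_div (hasDerivAt_id (p 1)) hρ
    have h := (((hasDerivAt_pow 2 (p 1)).const_mul ((α ^ 2 + β ^ 2) / (2 * lam)))).fun_mul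
      (((h0.fun_pow 2).fun_add (h1.fun_pow 2)).fun_sub
        ((((hq.const_mul 2).fun_mul h0).fun_mul h1).mul_const (Real.sin (p 0 / lam) ^ 2)))
    convert! h using 1
    · simp [gamDeriv]
      have := Real.sin_sq_add_cos_sq (p 0 / lam)
      have hc : Real.cos (p 0 / lam) ^ 2 = 1 - Real.sin (p 0 / lam) ^ 2 := by linarith
      rw [mul_pow, mul_pow, hc]
      field_simp
      ring
  · simpa [gamDeriv] using hasDerivAt_const (p 2) _
  · simpa [gamDeriv] using hasDerivAt_const (p 3) _

/-- Diagonal entries of the metric. -/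
noncomputable def metricDiag (α β lam : ℝ) (c : Fin 4) (p : Pt) : ℝ :=
  ![-Real.exp (2 * (gam α β lam p - psi β lam p)), Real.exp (2 * (gam α β lam p - psi β lam p)),
    p 1 ^ 2 * Real.exp (-2 * psi β lam p), Real.exp (2 * psi β lam p)] c

lemma metric_eq (α β lam : ℝ) (p : Pt) :
    metric α β lam p = Matrix.diagonal fun c => metricDiag α β lam c p := rfl

/-- Coefficient of `∂γ` in the derivative of the metric. -/
noncomputable def metricGam (α β lam : ℝ) (c : Fin 4) (p : Pt) : ℝ :=
  ![-(2 * Real.exp (2 * (gam α β lam p - psi β lam p))),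
    2 * Real.exp (2 * (gam α β lam p - psi β lam p)), 0, 0] c

/-- Coefficient of `∂ψ` in the derivative of the metric. -/
noncomputable def metricPsi (α β lam : ℝ) (c : Fin 4) (p : Pt) : ℝ :=
  ![2 * Real.exp (2 * (gam α β lam p - psi β lam p)),
    -(2 * Real.exp (2 * (gam α β lam p - psi β lam p))),
    -(2 * p 1 ^ 2 * Real.exp (-2 * psi β lam p)), 2 * Real.exp (2 * psi β lam p)] c

/-- Explicit `ρ`-derivative of the metric. -/
noncomputable def metricRadial (β lam : ℝ) (c : Fin 4) (p : Pt) : ℝ :=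
  ![0, 0, 2 * p 1 * Real.exp (-2 * psi β lam p), 0] c

/-- This form separates the oscillating factors `∂γ`, `∂ψ` from coefficients that converge locally
uniformly. -/
lemma hasDerivAt_metricDiag (α β : ℝ) {lam : ℝ} (hlam : 0 < lam) (i c : Fin 4) {p : Pt}
    (hp : p ∈ region) :
    HasDerivAt (fun s => metricDiag α β lam c (Function.update p i s))
      (metricGam α β lam c p * gamDeriv α β lam i p + metricPsi α β lam c p * psiDeriv β lam i p +
        if i = 1 then metricRadial β lam c p else 0) (p i) := by
  have hg := hasDerivAt_gam α β hlam i hp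
  have hs := hasDerivAt_psi β lam i p
  have hself : Function.update p i (p i) = p := Function.update_eq_self i p
  have he := ((hg.fun_sub hs).const_mul 2).exp
  have hm := (hs.const_mul (-2)).exp
  have hz := (hs.const_mul 2).exp
  simp only [hself] at he hm hz
  fin_cases c
  · convert! he.fun_neg using 1
    simp [metricGam, metricPsi, metricRadial]; ring
  · convert! he using 1
    simp [metricGam, metricPsi, metricRadial]; ring
  · have hr : HasDerivAt (fun s => Function.update p i s 1 ^ 2) (if i = 1 then 2 * p 1 else 0)
        (p i) := by
      split_ifs with h
      · subst h; simpa using hasDerivAt_pow 2 (p 1)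
      · simpa [Function.update_of_ne (Ne.symm h)] using hasDerivAt_const (p i) _
    convert! hr.fun_mul hm using 1
    simp only [hself]
    split_ifs <;> simp [metricGam, metricPsi, metricRadial] <;> ring
  · convert! hz using 1
    simp [metricGam, metricPsi, metricRadial]; ring

/-! ### Asymptotics of the metric functions -/

lemma ne_zero_of_mem_region {p : Pt} (hp : p ∈ region) : p 1 ≠ 0 := ne_of_gt hp

lemma locallySmall_lam_div : LocallySmall fun lam p => lam / p 1 := fun p hp => by
  have h1 : Tendsto (fun z : ℝ × Pt => z.1) (𝓝[>] 0 ×ˢ 𝓝 p) (𝓝 0) :=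
    tendsto_fst.mono_right nhdsWithin_le_nhds
  have h2 : Tendsto (fun z : ℝ × Pt => z.2 1) (𝓝[>] 0 ×ˢ 𝓝 p) (𝓝 (p 1)) :=
    ((continuous_apply 1).tendsto p).comp tendsto_snd
  have := h1.div h2 (ne_zero_of_mem_region hp)
  rw [zero_div] at this
  exact this

/-- Near a point with `ρ > 0` and for small `lam` the argument `ρ/lam` exceeds `1`, and the bound
becomes `C lam/ρ`. -/
lemma locallySmall_of_le_div {f : ℝ → ℝ} {C : ℝ} (hf : ∀ x, 1 ≤ x → |f x| ≤ C / x) :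
    LocallySmall fun lam p => f (p 1 / lam) := fun p hp => by
  have h := locallySmall_lam_div p hp
  have h0 : Tendsto (fun z : ℝ × Pt => C * (z.1 / z.2 1)) (𝓝[>] 0 ×ˢ 𝓝 p) (𝓝 0) := by
    simpa using h.const_mul C
  refine squeeze_zero_norm' ?_ h0
  filter_upwards [h.eventually (gt_mem_nhds one_pos),
    prod_mem_prod self_mem_nhdsWithin (isOpen_region.mem_nhds hp)] with z hz hz'
  have hl : 0 < z.1 := hz'.1
  have hr : 0 < z.2 1 := hz'.2
  have hx : 1 ≤ z.2 1 / z.1 := by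
    rw [one_le_div hl]; rw [div_lt_one hr] at hz; exact hz.le
  refine (hf _ hx).trans_eq ?_
  field_simp

/-- `√x J₀(x)` and `√x J₁(x)` at `x = ρ/lam`. -/
noncomputable def scaledBessel (n : ℕ) (lam : ℝ) (p : Pt) : ℝ :=
  √(p 1 / lam) * besselJ n (p 1 / lam)

/-- A phase for the asymptotics of the Bessel functions. -/
structure IsBesselPhase (δ : ℝ) : Prop where
  zero : LocallySmall fun lam p =>
    scaledBessel 0 lam p - √(2 / Real.pi) * Real.cos (p 1 / lam - δ)
  one : LocallySmall fun lam p =>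
    scaledBessel 1 lam p - √(2 / Real.pi) * Real.sin (p 1 / lam - δ)

lemma exists_isBesselPhase : ∃ δ, IsBesselPhase δ := by
  obtain ⟨δ, C, _, h⟩ := exists_phase_besselJ
  exact ⟨δ,
    locallySmall_of_le_div (f := fun x => √x * besselJ 0 x - √(2 / Real.pi) * Real.cos (x - δ))
      fun x hx => (h x hx).1,
    locallySmall_of_le_div (f := fun x => √x * besselJ 1 x - √(2 / Real.pi) * Real.sin (x - δ))
      fun x hx => (h x hx).2⟩

lemma locallyBdd_const_mul {f : ℝ → Pt → ℝ} (c : ℝ) (h : LocallyBdd f) :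
    LocallyBdd fun lam p => c * f lam p :=
  (locallyBdd_of_continuousOn (c := fun _ => c) continuousOn_const).mul h

lemma LocallySmall.locallyBdd_of_sub {f g : ℝ → Pt → ℝ}
    (h : LocallySmall fun lam p => f lam p - g lam p) (hg : LocallyBdd g) : LocallyBdd f :=
  fun p hp => ((h.locallyBdd.add hg) p hp).congr_left fun z => by ring

/-- Products of asymptotically equal bounded families are asymptotically equal. -/
lemma LocallySmall.mul_sub_mul {f f' g g' : ℝ → Pt → ℝ}
    (hf : LocallySmall fun lam p => f lam p - f' lam p)
    (hg : LocallySmall fun lam p => g lam p - g' lam p) (hf' : LocallyBdd f') (hg' : LocallyBdd g') :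
    LocallySmall fun lam p => f lam p * g lam p - f' lam p * g' lam p :=
  ((hf.mul_bdd (hg.locallyBdd_of_sub hg')).add (hf'.mul_small hg)).congr fun lam _ p _ => by ring

lemma locallyBdd_cos (δ : ℝ) :
    LocallyBdd fun lam p => √(2 / Real.pi) * Real.cos (p 1 / lam - δ) :=
  locallyBdd_const_mul _ (locallyBdd_of_abs_le fun _ _ => Real.abs_cos_le_one _)

lemma locallyBdd_sin (δ : ℝ) :
    LocallyBdd fun lam p => √(2 / Real.pi) * Real.sin (p 1 / lam - δ) :=
  locallyBdd_const_mul _ (locallyBdd_of_abs_le fun _ _ => Real.abs_sin_le_one _)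

lemma sqrt_two_div_pi_mul_self : √(2 / Real.pi) * √(2 / Real.pi) = 2 / Real.pi :=
  Real.mul_self_sqrt (by positivity)

lemma locallySmall_psi (b : ℝ) : LocallySmall (psi b) := by
  have h : LocallySmall fun lam _ => √lam := fun p _ => by
    have := (Real.continuous_sqrt.tendsto 0).comp
      ((tendsto_fst (f := 𝓝[>] (0 : ℝ)) (g := 𝓝 p)).mono_right nhdsWithin_le_nhds)
    rw [Real.sqrt_zero] at this
    exact this
  have hb : LocallyBdd fun lam p => b * waveF lam p :=
    locallyBdd_const_mul b ((locallyBdd_of_abs_le fun _ _ => abs_besselJ_le_one 0 _).mul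
      (locallyBdd_of_abs_le fun _ _ => Real.abs_sin_le_one _))
  exact (h.mul_bdd hb).congr fun lam _ p _ => by rw [psi]; ring

lemma scaledBessel_mul_scaledBessel {lam : ℝ} (hlam : 0 < lam) {p : Pt} (hp : p ∈ region) (m n : ℕ) :
    scaledBessel m lam p * scaledBessel n lam p =
      p 1 / lam * (besselJ m (p 1 / lam) * besselJ n (p 1 / lam)) := by
  have : √(p 1 / lam) * √(p 1 / lam) = p 1 / lam :=
    Real.mul_self_sqrt (div_nonneg (le_of_lt hp) hlam.le)
  unfold scaledBessel
  linear_combination besselJ m (p 1 / lam) * besselJ n (p 1 / lam) * this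

/-- In `x (J₀² + J₁²)` the squares of cosine and sine add up to the constant `2/π`, so nothing
oscillates at leading order; the cross term carries an extra `lam/ρ`. -/
lemma locallySmall_gam (α β : ℝ) : LocallySmall fun lam p => gam α β lam p - bgRate α β * p 1 := by
  obtain ⟨δ, hδ⟩ := exists_isBesselPhase
  have h00 := hδ.zero.mul_sub_mul hδ.zero (locallyBdd_cos δ) (locallyBdd_cos δ)
  have h11 := hδ.one.mul_sub_mul hδ.one (locallyBdd_sin δ) (locallyBdd_sin δ)
  have h01 : LocallyBdd fun lam p => scaledBessel 0 lam p * scaledBessel 1 lam p :=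
    (hδ.zero.locallyBdd_of_sub (locallyBdd_cos δ)).mul (hδ.one.locallyBdd_of_sub (locallyBdd_sin δ))
  have hs : LocallyBdd fun lam p => -2 * Real.sin (p 0 / lam) ^ 2 :=
    locallyBdd_const_mul _ (locallyBdd_of_abs_le (C := 1) fun lam p => by
      rw [abs_of_nonneg (sq_nonneg _)]; exact Real.sin_sq_le_one _)
  have hc : LocallyBdd fun _ p => (α ^ 2 + β ^ 2) / 2 * p 1 :=
    locallyBdd_of_continuousOn (c := fun p => (α ^ 2 + β ^ 2) / 2 * p 1) (by fun_prop)
  refine (hc.mul_small ((h00.add h11).add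
    (locallySmall_lam_div.mul_bdd (h01.mul hs)))).congr fun lam hlam p hp => ?_
  have hρ := ne_zero_of_mem_region hp
  have hl : lam ≠ 0 := ne_of_gt hlam
  rw [scaledBessel_mul_scaledBessel hlam hp, scaledBessel_mul_scaledBessel hlam hp, scaledBessel_mul_scaledBessel hlam hp,
    gam, bgRate]
  have h1 := sqrt_two_div_pi_mul_self
  have h2 := Real.sin_sq_add_cos_sq (p 1 / lam - δ)
  have e : ∀ c s : ℝ, s ^ 2 + c ^ 2 = 1 → √(2 / Real.pi) * c * (√(2 / Real.pi) * c) +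
      √(2 / Real.pi) * s * (√(2 / Real.pi) * s) = 2 / Real.pi := fun c s h => by
    linear_combination (s ^ 2 + c ^ 2) * h1 + 2 / Real.pi * h
  have e' := e _ _ h2
  have hpi := Real.pi_ne_zero
  have : (α ^ 2 + β ^ 2) / Real.pi * p 1 = (α ^ 2 + β ^ 2) / 2 * p 1 * (2 / Real.pi) := by
    field_simp
  have hg : (α ^ 2 + β ^ 2) / (2 * lam) * p 1 ^ 2 * (besselJ 0 (p 1 / lam) ^ 2 +
      besselJ 1 (p 1 / lam) ^ 2 - 2 * (lam / p 1) * besselJ 0 (p 1 / lam) * besselJ 1 (p 1 / lam) *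
        Real.sin (p 0 / lam) ^ 2) = (α ^ 2 + β ^ 2) / 2 * p 1 *
      (p 1 / lam * (besselJ 0 (p 1 / lam) * besselJ 0 (p 1 / lam)) +
        p 1 / lam * (besselJ 1 (p 1 / lam) * besselJ 1 (p 1 / lam)) +
        lam / p 1 * (p 1 / lam * (besselJ 0 (p 1 / lam) * besselJ 1 (p 1 / lam)) *
          (-2 * Real.sin (p 0 / lam) ^ 2))) := by
    field_simp
    ring
  rw [this, hg]
  linear_combination -((α ^ 2 + β ^ 2) / 2 * p 1) * e'

lemma LocallySmall.exp_sub {f : ℝ → Pt → ℝ} {f₀ : Pt → ℝ}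
    (h : LocallySmall fun lam p => f lam p - f₀ p) (hf₀ : ContinuousOn f₀ region) :
    LocallySmall fun lam p => Real.exp (f lam p) - Real.exp (f₀ p) := fun p hp => by
  have h1 : Tendsto (fun z : ℝ × Pt => f₀ z.2) (𝓝[>] 0 ×ˢ 𝓝 p) (𝓝 (f₀ p)) :=
    (hf₀.continuousAt (isOpen_region.mem_nhds hp)).tendsto.comp tendsto_snd
  have h2 : Tendsto (fun z : ℝ × Pt => f z.1 z.2) (𝓝[>] 0 ×ˢ 𝓝 p) (𝓝 (f₀ p)) := by
    simpa using (h p hp).add h1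
  simpa using ((Real.continuous_exp.tendsto _).comp h2).sub
    ((Real.continuous_exp.tendsto _).comp h1)

lemma LocallySmall.const_mul {f : ℝ → Pt → ℝ} (h : LocallySmall f) {c : Pt → ℝ}
    (hc : ContinuousOn c region) : LocallySmall fun lam p => c p * f lam p :=
  (locallyBdd_of_continuousOn hc).mul_small h

lemma continuous_psi (b lam : ℝ) : Continuous (psi b lam) := by
  unfold psi waveF; fun_prop

lemma continuousOn_gam (α β lam : ℝ) : ContinuousOn (gam α β lam) region := by
  unfold gam
  have h : ContinuousOn (fun p : Pt => lam / p 1) region :=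
    continuousOn_const.div (continuous_apply 1).continuousOn fun p hp => ne_zero_of_mem_region hp
  fun_prop

lemma continuousOn_exp_gam (α β lam : ℝ) :
    ContinuousOn (fun p => Real.exp (2 * (gam α β lam p - psi β lam p))) region :=
  Real.continuous_exp.comp_continuousOn
    (continuousOn_const.mul ((continuousOn_gam α β lam).sub (continuous_psi β lam).continuousOn))

lemma continuous_exp_psi (c b lam : ℝ) : Continuous fun p => Real.exp (c * psi b lam p) :=
  Real.continuous_exp.comp (continuous_const.mul (continuous_psi b lam))

lemma locallySmall_exp_gam (α β : ℝ) : LocallySmall fun lam p =>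
    Real.exp (2 * (gam α β lam p - psi β lam p)) - Real.exp (2 * bgRate α β * p 1) := by
  refine LocallySmall.exp_sub (f₀ := fun p => 2 * bgRate α β * p 1) ?_ (by fun_prop)
  refine (LocallySmall.const_mul (((locallySmall_gam α β).add
    ((locallySmall_psi β).const_mul (c := fun _ => -1) continuousOn_const)))
    (c := fun _ => 2) continuousOn_const).congr fun lam _ p _ => by ring

lemma locallySmall_exp_psi (c b : ℝ) :
    LocallySmall fun lam p => Real.exp (c * psi b lam p) - 1 := by
  have := LocallySmall.exp_sub (f := fun lam p => c * psi b lam p) (f₀ := fun _ => 0)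
    (by simpa using (locallySmall_psi b).const_mul (c := fun _ => c) continuousOn_const)
    continuousOn_const
  simpa using this

lemma continuousOn_metricDiag (α β lam : ℝ) (c : Fin 4) :
    ContinuousOn (metricDiag α β lam c) region := by
  have h1 := continuousOn_exp_gam α β lam
  fin_cases c
  · exact h1.neg
  · exact h1
  · exact (((continuous_apply 1).pow 2).mul (continuous_exp_psi (-2) β lam)).continuousOn
  · exact (continuous_exp_psi 2 β lam).continuousOn

lemma continuousOn_metricGam (α β lam : ℝ) (c : Fin 4) :
    ContinuousOn (metricGam α β lam c) region := by
  have h1 := continuousOn_const.mul (continuousOn_exp_gam α β lam) (f := fun _ => 2)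
  fin_cases c
  · exact h1.neg
  · exact h1
  · exact continuousOn_const
  · exact continuousOn_const

lemma continuousOn_metricPsi (α β lam : ℝ) (c : Fin 4) :
    ContinuousOn (metricPsi α β lam c) region := by
  have h1 := continuousOn_const.mul (continuousOn_exp_gam α β lam) (f := fun _ => 2)
  fin_cases c
  · exact h1
  · exact h1.neg
  · exact ((continuous_const.mul ((continuous_apply 1).pow 2)).mul
      (continuous_exp_psi (-2) β lam)).neg.continuousOn
  · exact (continuous_const.mul (continuous_exp_psi 2 β lam)).continuousOn

lemma continuous_metricRadial (β lam : ℝ) (c : Fin 4) : Continuous (metricRadial β lam c) := by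
  fin_cases c
  · exact continuous_const
  · exact continuous_const
  · exact (continuous_const.mul (continuous_apply 1)).mul (continuous_exp_psi (-2) β lam)
  · exact continuous_const

lemma continuous_bgDiag (k : ℝ) (c : Fin 4) : Continuous fun p : Pt => bgDiag k c (p 1) :=
  (continuous_iff_continuousAt.2 fun ρ => (hasDerivAt_bgDiag k c ρ).continuousAt).comp
    (continuous_apply 1)

lemma locallySmall_metricDiag (α β : ℝ) (c : Fin 4) :
    LocallySmall fun lam p => metricDiag α β lam c p - bgDiag (bgRate α β) c (p 1) := by
  have h1 := locallySmall_exp_gam α β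
  fin_cases c
  · exact (h1.const_mul (c := fun _ => -1) continuousOn_const).congr fun lam _ p _ => by
      simp [metricDiag, bgDiag]; ring
  · exact h1
  · exact ((locallySmall_exp_psi (-2) β).const_mul (c := fun p => p 1 ^ 2) (by fun_prop)).congr
      fun lam _ p _ => by simp [metricDiag, bgDiag]; ring
  · exact locallySmall_exp_psi 2 β

/-- Limit of `metricGam`. -/
noncomputable def bgGam (k : ℝ) (c : Fin 4) (p : Pt) : ℝ :=
  ![-(2 * Real.exp (2 * k * p 1)), 2 * Real.exp (2 * k * p 1), 0, 0] c

/-- Limit of `metricPsi`. -/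
noncomputable def bgPsi (k : ℝ) (c : Fin 4) (p : Pt) : ℝ :=
  ![2 * Real.exp (2 * k * p 1), -(2 * Real.exp (2 * k * p 1)), -(2 * p 1 ^ 2), 2] c

lemma continuous_bgGam (k : ℝ) (c : Fin 4) : Continuous (bgGam k c) := by
  unfold bgGam; fin_cases c <;> simp <;> fun_prop

lemma continuous_bgPsi (k : ℝ) (c : Fin 4) : Continuous (bgPsi k c) := by
  unfold bgPsi; fin_cases c <;> simp <;> fun_prop

lemma locallySmall_metricGam (α β : ℝ) (c : Fin 4) :
    LocallySmall fun lam p => metricGam α β lam c p - bgGam (bgRate α β) c p := by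
  have h1 := locallySmall_exp_gam α β
  fin_cases c
  · exact (h1.const_mul (c := fun _ => -2) continuousOn_const).congr fun lam _ p _ => by
      simp [metricGam, bgGam]; ring
  · exact (h1.const_mul (c := fun _ => 2) continuousOn_const).congr fun lam _ p _ => by
      simp [metricGam, bgGam]; ring
  · exact LocallySmall.zero.congr fun lam _ p _ => by simp [metricGam, bgGam]
  · exact LocallySmall.zero.congr fun lam _ p _ => by simp [metricGam, bgGam]

lemma locallySmall_metricPsi (α β : ℝ) (c : Fin 4) :
    LocallySmall fun lam p => metricPsi α β lam c p - bgPsi (bgRate α β) c p := by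
  have h1 := locallySmall_exp_gam α β
  fin_cases c
  · exact (h1.const_mul (c := fun _ => 2) continuousOn_const).congr fun lam _ p _ => by
      simp [metricPsi, bgPsi]; ring
  · exact (h1.const_mul (c := fun _ => -2) continuousOn_const).congr fun lam _ p _ => by
      simp [metricPsi, bgPsi]; ring
  · exact ((locallySmall_exp_psi (-2) β).const_mul (c := fun p => -(2 * p 1 ^ 2))
      (by fun_prop)).congr fun lam _ p _ => by simp [metricPsi, bgPsi]; ring
  · exact ((locallySmall_exp_psi 2 β).const_mul (c := fun _ => 2) continuousOn_const).congr
      fun lam _ p _ => by simp [metricPsi, bgPsi]; ring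

/-- The nonoscillating part of the `ρ`-derivative of the perturbation is small. -/
lemma locallySmall_radial_remainder (α β : ℝ) (c : Fin 4) :
    LocallySmall fun lam p => metricGam α β lam c p * bgRate α β + metricRadial β lam c p -
      bgDiagDeriv (bgRate α β) c (p 1) := by
  have h1 := (locallySmall_metricGam α β c).const_mul (c := fun _ => bgRate α β) continuousOn_const
  have h2 : LocallySmall fun lam p => metricRadial β lam c p - ![0, 0, 2 * p 1, 0] c := by
    fin_cases c
    · exact LocallySmall.zero.congr fun lam _ p _ => by simp [metricRadial]
    · exact LocallySmall.zero.congr fun lam _ p _ => by simp [metricRadial]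
    · exact ((locallySmall_exp_psi (-2) β).const_mul (c := fun p => 2 * p 1) (by fun_prop)).congr
        fun lam _ p _ => by simp [metricRadial]; ring
    · exact LocallySmall.zero.congr fun lam _ p _ => by simp [metricRadial]
  refine (h1.add h2).congr fun lam _ p _ => ?_
  have : bgDiagDeriv (bgRate α β) c (p 1) =
      bgRate α β * bgGam (bgRate α β) c p + ![0, 0, 2 * p 1, 0] c := by
    fin_cases c <;> simp [bgDiagDeriv, bgGam] <;> ring
  rw [this]; ring

/-! ### Wave forms of the derivatives -/

/-- Signs of the waves in `∂ψ`. -/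
def psiSign : Matrix (Fin 4) (Fin 4) ℝ := !![1, 1, 0, 0; 1, -1, 0, 0; 0, 0, 0, 0; 0, 0, 0, 0]

/-- Signs of the waves in `∂γ`. -/
def gamSign : Matrix (Fin 4) (Fin 4) ℝ := !![0, 0, 1, -1; 0, 0, 1, 1; 0, 0, 0, 0; 0, 0, 0, 0]

/-- Wave amplitudes of `∂ψ`. -/
noncomputable def psiCoeff (b : ℝ) (a k : Fin 4) (p : Pt) : ℝ :=
  b * √(2 / Real.pi) / 2 * (√(p 1))⁻¹ * psiSign a k

/-- Wave amplitudes of the oscillating part of `∂γ`. -/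
noncomputable def gamCoeff (r : ℝ) (a k : Fin 4) : ℝ := r / 2 * gamSign a k

lemma continuousOn_inv_sqrt : ContinuousOn (fun p : Pt => (√(p 1))⁻¹) region :=
  ((Real.continuous_sqrt.comp (continuous_apply 1)).continuousOn).inv₀ fun _ hp =>
    (Real.sqrt_pos.2 hp).ne'

lemma continuous_psiDeriv (b lam : ℝ) (a : Fin 4) : Continuous (psiDeriv b lam a) := by
  unfold psiDeriv; fin_cases a <;> simp <;> fun_prop

lemma continuous_gamDeriv (α β lam : ℝ) (a : Fin 4) : Continuous (gamDeriv α β lam a) := by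
  unfold gamDeriv; fin_cases a <;> simp <;> fun_prop

/-- The factor `lam^{-1/2}` left by differentiation is exactly what scales `J₀(ρ/lam)` to order one,
so `∂ψ` neither decays nor blows up. -/
lemma psiDeriv_zero_eq (b : ℝ) {lam : ℝ} (hlam : 0 < lam) {p : Pt} (hp : p ∈ region) :
    psiDeriv b lam 0 p = b * (√(p 1))⁻¹ * (scaledBessel 0 lam p * Real.cos (p 0 / lam)) := by
  have h1 : √lam ≠ 0 := (Real.sqrt_pos.2 hlam).ne'
  have h2 : √(p 1) ≠ 0 := (Real.sqrt_pos.2 hp).ne'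
  have h3 : √lam / lam = (√lam)⁻¹ := by rw [Real.sqrt_div_self', one_div]
  simp only [psiDeriv, scaledBessel, Real.sqrt_div (le_of_lt hp : (0 : ℝ) ≤ p 1), mul_div_assoc, h3]
  simp
  field_simp

lemma psiDeriv_one_eq (b : ℝ) {lam : ℝ} (hlam : 0 < lam) {p : Pt} (hp : p ∈ region) :
    psiDeriv b lam 1 p = -(b * (√(p 1))⁻¹ * (scaledBessel 1 lam p * Real.sin (p 0 / lam))) := by
  have h1 : √lam ≠ 0 := (Real.sqrt_pos.2 hlam).ne'
  have h2 : √(p 1) ≠ 0 := (Real.sqrt_pos.2 hp).ne'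
  have h3 : √lam / lam = (√lam)⁻¹ := by rw [Real.sqrt_div_self', one_div]
  simp only [psiDeriv, scaledBessel, Real.sqrt_div (le_of_lt hp : (0 : ℝ) ≤ p 1), mul_div_assoc, h3]
  simp
  field_simp

lemma locallyBdd_sin_time : LocallyBdd fun lam p => Real.sin (p 0 / lam) :=
  locallyBdd_of_abs_le fun _ _ => Real.abs_sin_le_one _

lemma locallyBdd_cos_time : LocallyBdd fun lam p => Real.cos (p 0 / lam) :=
  locallyBdd_of_abs_le fun _ _ => Real.abs_cos_le_one _

lemma hasWaveForm_psiDeriv {δ : ℝ} (hδ : IsBesselPhase δ) (b : ℝ) (a : Fin 4) :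
    HasWaveForm δ (fun lam => psiDeriv b lam a) (psiCoeff b a) where
  cont lam _ := (continuous_psiDeriv b lam a).continuousOn
  contCoeff k := (continuousOn_const.mul continuousOn_inv_sqrt).mul continuousOn_const
  small := by
    have hb := locallyBdd_of_continuousOn (continuousOn_const.mul continuousOn_inv_sqrt
      (f := fun _ => b))
    fin_cases a
    · refine (hδ.zero.mul_bdd (hb.mul locallyBdd_cos_time)).congr fun lam hlam p hp => ?_
      -- The left side is the form in which `fin_cases` leaves the index.
      have e : psiDeriv b lam ((fun i => i) ⟨0, by decide⟩) p = psiDeriv b lam 0 p := rfl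
      simp only [e, psiDeriv_zero_eq b hlam hp, Fin.sum_univ_four]
      simp [psiCoeff, psiSign, wave, waveNum, waveFreq, Real.cos_add]
      ring
    · refine (hδ.one.mul_bdd (hb.mul (locallyBdd_const_mul (-1) locallyBdd_sin_time))).congr
        fun lam hlam p hp => ?_
      have e : psiDeriv b lam ((fun i => i) ⟨1, by decide⟩) p = psiDeriv b lam 1 p := rfl
      simp only [e, psiDeriv_one_eq b hlam hp, Fin.sum_univ_four]
      simp [psiCoeff, psiSign, wave, waveNum, waveFreq, Real.cos_add]
      ring
    · exact LocallySmall.zero.congr fun lam _ p _ => by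
        simp [psiDeriv, psiCoeff, psiSign, Fin.sum_univ_four]
    · exact LocallySmall.zero.congr fun lam _ p _ => by
        simp [psiDeriv, psiCoeff, psiSign, Fin.sum_univ_four]

lemma gamDeriv_zero_eq (α β : ℝ) {lam : ℝ} (hlam : 0 < lam) {p : Pt} (hp : p ∈ region) :
    gamDeriv α β lam 0 p = -2 * (α ^ 2 + β ^ 2) * (scaledBessel 0 lam p * scaledBessel 1 lam p *
      (Real.sin (p 0 / lam) * Real.cos (p 0 / lam))) := by
  rw [scaledBessel_mul_scaledBessel hlam hp]
  simp [gamDeriv]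
  ring

lemma gamDeriv_one_eq (α β : ℝ) {lam : ℝ} (hlam : 0 < lam) {p : Pt} (hp : p ∈ region) :
    gamDeriv α β lam 1 p = (α ^ 2 + β ^ 2) *
      (scaledBessel 1 lam p * scaledBessel 1 lam p * (Real.sin (p 0 / lam) * Real.sin (p 0 / lam)) +
      scaledBessel 0 lam p * scaledBessel 0 lam p *
        (Real.cos (p 0 / lam) * Real.cos (p 0 / lam))) := by
  rw [scaledBessel_mul_scaledBessel hlam hp, scaledBessel_mul_scaledBessel hlam hp]
  simp [gamDeriv]
  ring

/-- The identity `sin²X sin²s + cos²X cos²s = (1 + cos 2X cos 2s)/2` gives `∂_ρ γ` the mean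
`bgRate`, the slope of the limit of `γ`; only the rest oscillates. For `∂_t γ` the product `sin 2X
sin 2s` has no mean. -/
lemma hasWaveForm_gamDeriv {δ : ℝ} (hδ : IsBesselPhase δ) (α β : ℝ) (a : Fin 4) :
    HasWaveForm δ (fun lam p => gamDeriv α β lam a p - if a = 1 then bgRate α β else 0)
      (fun k _ => gamCoeff (bgRate α β) a k) where
  cont lam _ := ((continuous_gamDeriv α β lam a).sub continuous_const).continuousOn
  contCoeff k := continuousOn_const
  small := by
    have hA := sqrt_two_div_pi_mul_self
    have hr : bgRate α β = (α ^ 2 + β ^ 2) / 2 * (√(2 / Real.pi) * √(2 / Real.pi)) := by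
      rw [hA, bgRate]; ring
    fin_cases a
    · refine ((hδ.zero.mul_sub_mul hδ.one (locallyBdd_cos δ) (locallyBdd_sin δ)).mul_bdd
        (locallyBdd_const_mul (-2 * (α ^ 2 + β ^ 2))
          (locallyBdd_sin_time.mul locallyBdd_cos_time))).congr fun lam hlam p hp => ?_
      have e : gamDeriv α β lam ((fun i => i) ⟨0, by decide⟩) p = gamDeriv α β lam 0 p := rfl
      simp only [e, gamDeriv_zero_eq α β hlam hp, Fin.sum_univ_four]
      simp [gamCoeff, gamSign, wave, waveNum, waveFreq, Real.cos_add, Real.sin_two_mul, hr]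
      ring
    · refine (((hδ.one.mul_sub_mul hδ.one (locallyBdd_sin δ) (locallyBdd_sin δ)).mul_bdd
        (locallyBdd_const_mul (α ^ 2 + β ^ 2) (locallyBdd_sin_time.mul locallyBdd_sin_time))).add
        ((hδ.zero.mul_sub_mul hδ.zero (locallyBdd_cos δ) (locallyBdd_cos δ)).mul_bdd
        (locallyBdd_const_mul (α ^ 2 + β ^ 2)
          (locallyBdd_cos_time.mul locallyBdd_cos_time)))).congr fun lam hlam p hp => ?_
      have e : gamDeriv α β lam ((fun i => i) ⟨1, by decide⟩) p = gamDeriv α β lam 1 p := rfl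
      simp only [e, gamDeriv_one_eq α β hlam hp, Fin.sum_univ_four]
      simp [gamCoeff, gamSign, wave, waveNum, waveFreq, Real.cos_add, Real.cos_two_mul, hr]
      have h1 := Real.sin_sq_add_cos_sq (p 1 / lam - δ)
      have h2 := Real.sin_sq_add_cos_sq (p 0 / lam)
      generalize Real.cos (p 1 / lam - δ) = C at *
      generalize Real.sin (p 1 / lam - δ) = S at *
      generalize Real.cos (p 0 / lam) = c at *
      generalize Real.sin (p 0 / lam) = s at *
      have e1 : S * S = 1 - C ^ 2 := by linarith
      have e2 : s * s = 1 - c ^ 2 := by linarith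
      have e3 : √2 / √Real.pi * S * (√2 / √Real.pi * S) =
        √2 / √Real.pi * (√2 / √Real.pi) * (S * S) := by ring
      rw [e3, e1, e2]
      ring
    · exact LocallySmall.zero.congr fun lam _ p _ => by
        simp [gamDeriv, gamCoeff, gamSign, Fin.sum_univ_four]
    · exact LocallySmall.zero.congr fun lam _ p _ => by
        simp [gamDeriv, gamCoeff, gamSign, Fin.sum_univ_four]

/-! ### Weak limits -/

/-- Diagonal entries of the perturbation. -/
noncomputable def pertDiag (α β lam : ℝ) (c : Fin 4) (p : Pt) : ℝ :=
  metricDiag α β lam c p - bgDiag (bgRate α β) c (p 1)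

lemma perturbation_eq (α β lam : ℝ) (p : Pt) :
    perturbation α β lam p = Matrix.diagonal fun c => pertDiag α β lam c p := by
  rw [perturbation, metric_eq, background_eq, Matrix.diagonal_sub]
  rfl

lemma hasDerivAt_comp_update {F : ℝ → ℝ} {F' : ℝ} {p : Pt} (h : HasDerivAt F F' (p 1)) (i : Fin 4) :
    HasDerivAt (fun s => F (Function.update p i s 1)) (if i = 1 then F' else 0) (p i) := by
  split_ifs with hi
  · subst hi; simpa using h
  · simpa [Function.update_of_ne (Ne.symm hi)] using hasDerivAt_const (p i) _

/-- The mean of `∂_ρ γ` is moved to the last bracket, where it and the explicit `ρ`-dependence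
cancel the background derivative in the limit. -/
lemma pd_perturbation (α β : ℝ) {lam : ℝ} (hlam : 0 < lam) (a c d : Fin 4) {p : Pt}
    (hp : p ∈ region) :
    pd a (fun q => perturbation α β lam q c d) p = if c = d then
      metricGam α β lam c p * (gamDeriv α β lam a p - if a = 1 then bgRate α β else 0) +
        metricPsi α β lam c p * psiDeriv β lam a p +
        (if a = 1 then metricGam α β lam c p * bgRate α β + metricRadial β lam c p -
          bgDiagDeriv (bgRate α β) c (p 1) else 0) else 0 := by
  simp only [perturbation_eq]
  split_ifs with hcd ha
  · subst hcd ha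
    simp only [Matrix.diagonal_apply_eq, pertDiag]
    have h := (hasDerivAt_metricDiag α β hlam 1 c hp).fun_sub
      (hasDerivAt_comp_update (hasDerivAt_bgDiag (bgRate α β) c (p 1)) 1)
    rw [if_pos rfl, if_pos rfl] at h
    rw [pd, h.deriv]
    ring
  · subst hcd
    simp only [Matrix.diagonal_apply_eq, pertDiag]
    have h := (hasDerivAt_metricDiag α β hlam a c hp).fun_sub
      (hasDerivAt_comp_update (hasDerivAt_bgDiag (bgRate α β) c (p 1)) a)
    rw [if_neg ha, if_neg ha] at h
    rw [pd, h.deriv]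
    ring
  · simp [Matrix.diagonal_apply_ne _ hcd, pd]

/-- Wave amplitudes of `∇_a h_{cd}`. -/
noncomputable def covCoeff (α β : ℝ) (a c d k : Fin 4) (p : Pt) : ℝ :=
  if c = d then bgGam (bgRate α β) c p * gamCoeff (bgRate α β) a k +
    bgPsi (bgRate α β) c p * psiCoeff β a k p else 0

lemma continuousOn_bgGamma (k : ℝ) (c a b : Fin 4) :
    ContinuousOn (fun p : Pt => bgGamma k c a b (p 1)) region := fun _ hp =>
  (ContinuousAt.comp (f := fun p : Pt => p 1)
    (hasDerivAt_bgGamma k c a b (ne_zero_of_mem_region hp)).continuousAt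
    (continuous_apply 1).continuousAt).continuousWithinAt

lemma continuous_bgDiagDeriv (k : ℝ) (c : Fin 4) :
    Continuous fun p : Pt => bgDiagDeriv k c (p 1) := by
  unfold bgDiagDeriv; fin_cases c <;> simp <;> fun_prop

lemma continuousOn_pertDiag (α β lam : ℝ) (c : Fin 4) :
    ContinuousOn (pertDiag α β lam c) region :=
  (continuousOn_metricDiag α β lam c).sub (continuous_bgDiag _ c).continuousOn

lemma hasWaveForm_pertDiag {δ : ℝ} (α β : ℝ) (c : Fin 4) {w : Pt → ℝ}
    (hw : ContinuousOn w region) :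
    HasWaveForm δ (fun lam p => w p * pertDiag α β lam c p) fun _ _ => 0 :=
  HasWaveForm.of_small ((locallySmall_metricDiag α β c).const_mul hw)
    fun lam _ => hw.mul (continuousOn_pertDiag α β lam c)

/-- The Christoffel terms multiply undifferentiated `h`, which is locally small, so only partial
derivatives contribute amplitudes. -/
lemma hasWaveForm_covDeriv {δ : ℝ} (hδ : IsBesselPhase δ) (α β : ℝ) (a c d : Fin 4) :
    HasWaveForm δ (fun lam p => covDeriv (background α β) (perturbation α β lam) p a c d)
      (covCoeff α β a c d) := by
  have hrem : HasWaveForm δ (fun lam p => if a = 1 then metricGam α β lam c p * bgRate α β +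
      metricRadial β lam c p - bgDiagDeriv (bgRate α β) c (p 1) else 0) fun _ _ => 0 := by
    by_cases ha : a = 1
    · simp only [if_pos ha]
      exact HasWaveForm.of_small (locallySmall_radial_remainder α β c) fun lam _ =>
        (((continuousOn_metricGam α β lam c).mul continuousOn_const).add
          (continuous_metricRadial β lam c).continuousOn).sub
          (continuous_bgDiagDeriv _ c).continuousOn
    · simp only [if_neg ha]
      exact HasWaveForm.of_small LocallySmall.zero fun _ _ => continuousOn_const
  have hmain := (((hasWaveForm_gamDeriv hδ α β a).mul_convergent
    (fun lam _ => continuousOn_metricGam α β lam c) (continuous_bgGam _ c).continuousOn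
    (locallySmall_metricGam α β c)).add ((hasWaveForm_psiDeriv hδ β a).mul_convergent
    (fun lam _ => continuousOn_metricPsi α β lam c) (continuous_bgPsi _ c).continuousOn
    (locallySmall_metricPsi α β c))).add hrem
  have hind : HasWaveForm δ (fun lam p => pd a (fun q => perturbation α β lam q c d) p)
      (covCoeff α β a c d) := by
    by_cases hcd : c = d
    · refine hmain.congr (fun lam hlam p hp => ?_) fun k p _ => ?_
      · rw [pd_perturbation α β hlam a c d hp, if_pos hcd]
      · rw [covCoeff, if_pos hcd, add_zero]
    · refine (HasWaveForm.of_small LocallySmall.zero fun _ _ => continuousOn_const).congr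
        (fun lam hlam p hp => ?_) fun k p _ => ?_
      · rw [pd_perturbation α β hlam a c d hp, if_neg hcd]
      · rw [covCoeff, if_neg hcd]
  have h1 := hasWaveForm_pertDiag (δ := δ) α β d (continuousOn_bgGamma (bgRate α β) d a c).neg
  have h2 := hasWaveForm_pertDiag (δ := δ) α β c (continuousOn_bgGamma (bgRate α β) c a d).neg
  refine ((hind.add h1).add h2).congr (fun lam hlam p hp => ?_) fun k p _ => by simp
  simp only [covDeriv, christoffel_background α β _ _ _ hp]
  rw [perturbation_eq, Finset.sum_eq_single d (fun e _ he => by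
      rw [Matrix.diagonal_apply_ne _ he, mul_zero]) (by simp),
    Finset.sum_eq_single c (fun e _ he => by
      rw [Matrix.diagonal_apply_ne _ he.symm, mul_zero]) (by simp),
    Matrix.diagonal_apply_eq, Matrix.diagonal_apply_eq]
  simp only [Pi.neg_apply]
  ring

lemma sum_gamCoeff_mul_gamCoeff (r : ℝ) (a b : Fin 4) :
    ∑ k, gamCoeff r a k * gamCoeff r b k =
      if a = b ∧ (a = 0 ∨ a = 1) then r ^ 2 / 2 else 0 := by
  simp only [gamCoeff, Fin.sum_univ_four]
  fin_cases a <;> fin_cases b <;> simp [gamSign] <;> ring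

lemma sum_psiCoeff_mul_psiCoeff (β : ℝ) (a b : Fin 4) {p : Pt} (hp : p ∈ region) :
    ∑ k, psiCoeff β a k p * psiCoeff β b k p =
      if a = b ∧ (a = 0 ∨ a = 1) then β ^ 2 / (Real.pi * p 1) else 0 := by
  have h1 := sqrt_two_div_pi_mul_self
  have h2 : √(p 1) * √(p 1) = p 1 := Real.mul_self_sqrt (le_of_lt hp)
  have h3 : √(2 / Real.pi) * (√(p 1))⁻¹ * (√(2 / Real.pi) * (√(p 1))⁻¹) =
      2 / (Real.pi * p 1) := by
    rw [mul_mul_mul_comm, h1, ← mul_inv, h2]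
    field_simp
  have h4 : ∑ k, psiCoeff β a k p * psiCoeff β b k p = β ^ 2 / 4 *
      (√(2 / Real.pi) * (√(p 1))⁻¹ * (√(2 / Real.pi) * (√(p 1))⁻¹)) *
      ∑ k, psiSign a k * psiSign b k := by
    rw [Finset.mul_sum]
    refine Finset.sum_congr rfl fun k _ => ?_
    rw [psiCoeff, psiCoeff]; ring
  have h5 : ∑ k, psiSign a k * psiSign b k = if a = b ∧ (a = 0 ∨ a = 1) then 2 else 0 := by
    simp only [Fin.sum_univ_four]
    fin_cases a <;> fin_cases b <;> simp [psiSign] <;> norm_num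
  rw [h4, h3, h5]
  split_ifs
  · ring
  · ring

/-- The amplitudes have disjoint supports: `∂ψ` uses the simple frequencies and `∂γ` the doubled
ones. -/
lemma sum_gamCoeff_mul_psiCoeff (r β : ℝ) (a b : Fin 4) (p : Pt) :
    ∑ k, gamCoeff r a k * psiCoeff β b k p = 0 := by
  simp only [gamCoeff, psiCoeff, Fin.sum_univ_four]
  fin_cases a <;> fin_cases b <;> simp [gamSign, psiSign]

lemma sum_covCoeff_mul_covCoeff (α β : ℝ) (i : Fin 6 → Fin 4) {p : Pt} (hp : p ∈ region) :
    (∑ k, covCoeff α β (i 0) (i 2) (i 3) k p * covCoeff α β (i 1) (i 4) (i 5) k p) / 2 =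
      mu α β p i := by
  unfold mu covCoeff
  generalize i 0 = a, i 1 = b, i 2 = c, i 3 = d, i 4 = e, i 5 = f
  by_cases hcd : c = d
  swap
  · simp [hcd]
  by_cases hef : e = f
  swap
  · simp [hef]
  simp only [hcd, hef, if_true, and_true]
  have hexp : ∀ A B A' B' : ℝ, ∑ k, (A * gamCoeff (bgRate α β) a k + B * psiCoeff β a k p) *
      (A' * gamCoeff (bgRate α β) b k + B' * psiCoeff β b k p) =
      A * A' * (∑ k, gamCoeff (bgRate α β) a k * gamCoeff (bgRate α β) b k) +
      B * B' * (∑ k, psiCoeff β a k p * psiCoeff β b k p) +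
      A * B' * (∑ k, gamCoeff (bgRate α β) a k * psiCoeff β b k p) +
      B * A' * (∑ k, gamCoeff (bgRate α β) b k * psiCoeff β a k p) := fun A B A' B' => by
    simp only [Finset.mul_sum, ← Finset.sum_add_distrib]
    exact Finset.sum_congr rfl fun k _ => by ring
  rw [hexp, sum_gamCoeff_mul_psiCoeff, sum_gamCoeff_mul_psiCoeff, sum_gamCoeff_mul_gamCoeff,
    sum_psiCoeff_mul_psiCoeff β a b hp]
  split_ifs with h
  · have hρ := ne_zero_of_mem_region hp
    rw [muTable_eq]
    fin_cases d <;> fin_cases f <;> simp [bgGam, bgPsi] <;> field_simp <;> ring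
  · simp

lemma weakConv_gradProduct (α β : ℝ) (i : Fin 6 → Fin 4) :
    WeakConv (fun lam p => gradProduct α β lam p i) fun p => mu α β p i := by
  obtain ⟨δ, hδ⟩ := exists_isBesselPhase
  exact ((hasWaveForm_covDeriv hδ α β (i 0) (i 2) (i 3)).weakConv_mul
    (hasWaveForm_covDeriv hδ α β (i 1) (i 4) (i 5))).congr (fun _ _ _ _ => rfl)
    fun p hp => sum_covCoeff_mul_covCoeff α β i hp

lemma pd_scalarField (α lam : ℝ) (i : Fin 4) (p : Pt) :
    pd i (scalarField α lam) p = 1 / (2 * √Real.pi) * psiDeriv α lam i p :=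
  ((hasDerivAt_psi α lam i p).const_mul (1 / (2 * √Real.pi))).deriv

/-- Coefficient of `(∂_t φ)² - (∂_ρ φ)²` in the diagonal components of the stress tensor. -/
noncomputable def stressWeight (α β lam : ℝ) (a : Fin 4) (p : Pt) : ℝ :=
  1 / (8 * Real.pi) * (metricDiag α β lam a p *
    Real.exp (-2 * (gam α β lam p - psi β lam p)))

lemma stress_eq (α β lam : ℝ) {p : Pt} (hp : p ∈ region) (a b : Fin 4) :
    stress α β lam p a b = 1 / (4 * Real.pi) * psiDeriv α lam a p * psiDeriv α lam b p +
      if a = b then stressWeight α β lam a p * psiDeriv α lam 0 p * psiDeriv α lam 0 p +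
        -stressWeight α β lam a p * psiDeriv α lam 1 p * psiDeriv α lam 1 p else 0 := by
  have hρ := ne_zero_of_mem_region hp
  have hm : ∀ c, metricDiag α β lam c p ≠ 0 := fun c => by
    fin_cases c <;> simp [metricDiag, hρ]
  have hpi : 1 / (2 * √Real.pi) * (1 / (2 * √Real.pi)) = 1 / (4 * Real.pi) := by
    have := Real.mul_self_sqrt Real.pi_pos.le
    rw [← mul_div_mul_comm, one_mul]
    congr 1
    linear_combination 4 * this
  unfold stress scalarStress
  simp only [pd_scalarField]
  rw [metric_eq, inv_diagonal_of_ne_zero hm]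
  simp only [mul_assoc, sum_diagonal_mul (fun c => (metricDiag α β lam c p)⁻¹)
    (fun c d => 1 / (2 * √Real.pi) * (psiDeriv α lam c p *
      (1 / (2 * √Real.pi) * psiDeriv α lam d p)))]
  have h2 : psiDeriv α lam 2 p = 0 := rfl
  have h3 : psiDeriv α lam 3 p = 0 := rfl
  have h0 : (metricDiag α β lam 0 p)⁻¹ = -Real.exp (-2 * (gam α β lam p - psi β lam p)) := by
    simp [metricDiag, inv_neg, ← Real.exp_neg]
  have h1 : (metricDiag α β lam 1 p)⁻¹ = Real.exp (-2 * (gam α β lam p - psi β lam p)) := by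
    simp [metricDiag, ← Real.exp_neg]
  rw [Fin.sum_univ_four, h0, h1, h2, h3, stressWeight]
  have hpi' : 1 / (8 * Real.pi) = 1 / 2 * (1 / (2 * √Real.pi) * (1 / (2 * √Real.pi))) := by
    rw [hpi]; ring
  split_ifs with hab
  · subst hab
    rw [Matrix.diagonal_apply_eq, hpi', ← hpi]
    ring
  · rw [Matrix.diagonal_apply_ne _ hab, ← hpi]
    ring

/-- Limit of `stressWeight`. -/
noncomputable def bgStressWeight (k : ℝ) (a : Fin 4) (p : Pt) : ℝ :=
  1 / (8 * Real.pi) * (bgDiag k a (p 1) * Real.exp (-2 * k * p 1))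

lemma continuous_bgStressWeight (k : ℝ) (a : Fin 4) : Continuous (bgStressWeight k a) :=
  continuous_const.mul ((continuous_bgDiag k a).mul (by fun_prop))

lemma continuousOn_stressWeight (α β lam : ℝ) (a : Fin 4) :
    ContinuousOn (stressWeight α β lam a) region :=
  continuousOn_const.mul ((continuousOn_metricDiag α β lam a).mul
    (Real.continuous_exp.comp_continuousOn (continuousOn_const.mul
      ((continuousOn_gam α β lam).sub (continuous_psi β lam).continuousOn))))

lemma locallySmall_stressWeight (α β : ℝ) (a : Fin 4) :
    LocallySmall fun lam p => stressWeight α β lam a p - bgStressWeight (bgRate α β) a p := by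
  have h : LocallySmall fun lam p => Real.exp (-2 * (gam α β lam p - psi β lam p)) -
      Real.exp (-2 * bgRate α β * p 1) := by
    refine LocallySmall.exp_sub (f₀ := fun p => -2 * bgRate α β * p 1) ?_ (by fun_prop)
    refine (LocallySmall.const_mul (((locallySmall_gam α β).add
      ((locallySmall_psi β).const_mul (c := fun _ => -1) continuousOn_const)))
      (c := fun _ => -2) continuousOn_const).congr fun lam _ p _ => by ring
  exact (((locallySmall_metricDiag α β a).mul_sub_mul h
    (locallyBdd_of_continuousOn (continuous_bgDiag _ a).continuousOn)
    (locallyBdd_of_continuousOn (c := fun p => Real.exp (-2 * bgRate α β * p 1))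
      (by fun_prop))).const_mul (c := fun _ => 1 / (8 * Real.pi)) continuousOn_const).congr
    fun lam _ p _ => by rw [stressWeight, bgStressWeight]; ring

/-- The trace part carries `(∂_t φ)² - (∂_ρ φ)²`, whose two terms have equal averages, so only `∂_a
φ ∂_b φ` survives. -/
lemma weakConv_stress (α β : ℝ) (a b : Fin 4) :
    WeakConv (fun lam p => stress α β lam p a b) fun p => weakStress α p a b := by
  obtain ⟨δ, hδ⟩ := exists_isBesselPhase
  have hψ := hasWaveForm_psiDeriv hδ α
  have h1 := ((hψ a).continuousOn_mul (c := fun _ => 1 / (4 * Real.pi))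
    continuousOn_const).weakConv_mul (hψ b)
  have h2 := (((hψ 0).mul_convergent (fun lam _ => continuousOn_stressWeight α β lam a)
      (continuous_bgStressWeight _ a).continuousOn (locallySmall_stressWeight α β a)).weakConv_mul
      (hψ 0)).add
    (((hψ 1).mul_convergent (fun lam _ => (continuousOn_stressWeight α β lam a).neg)
      (continuous_bgStressWeight (bgRate α β) a).neg.continuousOn
      (((locallySmall_stressWeight α β a).const_mul (c := fun _ => -1)
        continuousOn_const).congr fun lam _ p _ => by
          simp only [Pi.neg_apply]; ring)).weakConv_mul (hψ 1))
  have h3 : WeakConv (fun lam p => if a = b then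
      stressWeight α β lam a p * psiDeriv α lam 0 p * psiDeriv α lam 0 p +
        -stressWeight α β lam a p * psiDeriv α lam 1 p * psiDeriv α lam 1 p else 0)
      fun _ => 0 := by
    by_cases hab : a = b
    · simp only [if_pos hab]
      refine h2.congr (fun _ _ _ _ => rfl) fun p hp => ?_
      simp only [mul_assoc, ← Finset.mul_sum, sum_psiCoeff_mul_psiCoeff α _ _ hp]
      simp
      ring
    · simp only [if_neg hab]
      exact WeakConv.const continuousOn_const
  refine (h1.add h3).congr (fun lam _ p hp => (stress_eq α β lam hp a b).symm) fun p hp => ?_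
  simp only [mul_assoc, ← Finset.mul_sum, sum_psiCoeff_mul_psiCoeff α _ _ hp, weakStress]
  have hρ := ne_zero_of_mem_region hp
  have hpi := Real.pi_ne_zero
  split_ifs
  · field_simp; ring
  · simp

lemma continuousOn_sqrt_det_background (α β : ℝ) :
    ContinuousOn (fun p => √|(background α β p).det|) region := by
  simp only [background_eq, Matrix.det_diagonal]
  exact (Real.continuous_sqrt.comp (continuous_finsetProd _ fun i _ =>
    continuous_bgDiag (bgRate α β) i).abs).continuousOn

lemma tendstoLocallyUniformlyOn_metric (α β : ℝ) (a b : Fin 4) :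
    TendstoLocallyUniformlyOn (fun lam p => metric α β lam p a b)
      (fun p => background α β p a b) (𝓝[>] 0) region := by
  refine LocallySmall.tendstoLocallyUniformlyOn ?_
  simp only [metric_eq, background_eq]
  by_cases hab : a = b
  · subst hab
    simpa only [Matrix.diagonal_apply_eq] using locallySmall_metricDiag α β a
  · simpa only [Matrix.diagonal_apply_ne _ hab, sub_zero] using LocallySmall.zero

lemma greenWald_eq_effectiveStress (α β : ℝ) {p : Pt} (hp : p ∈ region) (a b : Fin 4) :
    8 * Real.pi * effectiveStress α β p a b = greenWald (background α β) (mu α β) p a b := by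
  rw [effectiveStress_eq α β hp, greenWald_mu α β hp]
  have hρ := ne_zero_of_mem_region hp
  have hpi := Real.pi_ne_zero
  split_ifs
  · field_simp
  · simp

end EinsteinRosen

open EinsteinRosen
theorem mainTheorem2 (α β : ℝ) :
    -- the background metric is the limit of the family, locally uniformly on `ρ > 0`
    (∀ a b : Fin 4, TendstoLocallyUniformlyOn (fun lam p => metric α β lam p a b)
      (fun p => background α β p a b) (𝓝[>] 0) region) ∧
    -- weak limit of the energy-momentum tensor of the scalar field
    IsWeakLimit (background α β) (n := 2) (fun lam p i => stress α β lam p (i 0) (i 1))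
      (fun p i => weakStress α p (i 0) (i 1)) ∧
    -- Einstein tensor of the background
    (∀ p ∈ region, ∀ a b : Fin 4, einstein (background α β) p a b =
      if a = b ∧ (a = 0 ∨ a = 1) then (α ^ 2 + β ^ 2) / (Real.pi * p 1) else 0) ∧
    -- the effective energy-momentum tensor
    (∀ p ∈ region, ∀ a b : Fin 4, effectiveStress α β p a b =
      if a = b ∧ (a = 0 ∨ a = 1) then β ^ 2 / (8 * Real.pi ^ 2 * p 1) else 0) ∧
    -- it is traceless, satisfies the weak energy condition and does not depend on `α`
    (∀ p ∈ region, trace (background α β) (effectiveStress α β) p = 0) ∧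
    (∀ p ∈ region, WeakEnergyAt (background α β) (effectiveStress α β) p) ∧
    (∀ α' : ℝ, ∀ p ∈ region, ∀ a b : Fin 4,
      effectiveStress α' β p a b = effectiveStress α β p a b) ∧
    -- the weak limit `μ` of `∇h ∇h` exists, is smooth, and has the stated components
    IsWeakLimit (background α β) (gradProduct α β) (mu α β) ∧
    (∀ i, ContDiffOn ℝ ∞ (fun p => mu α β p i) region) ∧
    -- symmetries of `μ`
    (∀ p, ∀ a b c d e f : Fin 4,
      mu α β p ![a, b, c, d, e, f] = mu α β p ![b, a, c, d, e, f] ∧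
      mu α β p ![a, b, c, d, e, f] = mu α β p ![a, b, d, c, e, f] ∧
      mu α β p ![a, b, c, d, e, f] = mu α β p ![a, b, c, d, f, e] ∧
      mu α β p ![a, b, c, d, e, f] = mu α β p ![a, b, e, f, c, d]) ∧
    -- the Green-Wald formula applied to `μ` gives the same effective tensor
    (∀ p ∈ region, ∀ a b : Fin 4,
      8 * Real.pi * effectiveStress α β p a b = greenWald (background α β) (mu α β) p a b) := by
  refine ⟨tendstoLocallyUniformlyOn_metric α β, ?_, fun p hp => einstein_background α β hp,
    fun p hp => effectiveStress_eq α β hp, fun p hp => trace_effectiveStress α β hp,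
    fun p hp => weakEnergyAt_effectiveStress α β hp, fun α' p hp a b => ?_, ?_,
    contDiffOn_mu α β, mu_symmetries α β, fun p hp => greenWald_eq_effectiveStress α β hp⟩
  · exact isWeakLimit_of_components (continuousOn_sqrt_det_background α β)
      fun i => weakConv_stress α β (i 0) (i 1)
  · rw [effectiveStress_eq α' β hp, effectiveStress_eq α β hp]
  · exact isWeakLimit_of_components (continuousOn_sqrt_det_background α β)
      (weakConv_gradProduct α β)
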